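/- Setting. Let $G$ be a (Hausdorff, real, finite-dimensional) Lie group whose Lie algebra $\mathfrak g$ is semisimple and carries a fixed $|1|$-grading $\mathfrak g=\mathfrak g_{-1}\oplus\mathfrak g_0\oplus\mathfrak g_1$, $[\mathfrak g_i,\mathfrak g_j]\subset\mathfrak g_{i+j}$, such that no simple ideal of $\mathfrak g$ is contained in $\mathfrak g_0$. Let $P\subset G$ be a Lie subgroup with Lie algebra $\mathfrak p=\mathfrak g_0\oplus\mathfrak g_1$ which lies between the group of all $g\in G$ such that $\mathrm{Ad}_g$ preserves the filtration $\mathfrak g\supset\mathfrak g_0\oplus\mathfrak g_1\supset\mathfrak g_1$ and the identity component of that group, and let $G_0\subset P$ be the subgroup of those elements whose adjoint action preserves the grading. A $|1|$-graded geometry of type $(G,P)$ is a Cartan geometry of this type, i.e. a smooth principal $P$-bundle $p:\mathcal G\to M$ over a smooth (Hausdorff, second countable) manifold $M$ with a Cartan connection $\omega\in\Omega^1(\mathcal G,\mathfrak g)$. Put $\mathcal G_0=\mathcal G/\exp\mathfrak g_1$, with projections $\pi:\mathcal G\to\mathcal G_0$ and $p_0:\mathcal G_0\to M$. For $U\subset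 M$ open, a Weyl structure over $U$ is a smooth $G_0$-equivariant section $\sigma$ of $\pi$ over $p_0^{-1}(U)$; a Weyl structure is one over $U=M$. A $1$-form over $U$ is (identified with) a smooth map $\Upsilon:p_0^{-1}(U)\to\mathfrak g_1$ with $\Upsilon(ug)=\mathrm{Ad}_{g^{-1}}\Upsilon(u)$ for $g\in G_0$, and $\sigma+\Upsilon$ denotes the map $u\mapsto\sigma(u)\cdot\exp\Upsilon(u)$. A (local) automorphism $\varphi$ of the geometry is a $P$-equivariant diffeomorphism $p^{-1}(U)\to p^{-1}(V)$, with $U,V\subset M$ open, which covers a diffeomorphism $\underline\varphi:U\to V$ and satisfies $\varphi^*\omega=\omega$. It covers a symmetry with the center at $x\in U$ if $\underline\varphi(x)=x$ and $T_x\underline\varphi=-\mathrm{id}_{T_xM}$. Let $\varphi_0:p_0^{-1}(U)\to p_0^{-1}(V)$ be the map induced by $\varphi$. The pullback of a Weyl structure $\sigma$ is $\varphi^*\sigma=\varphi^{-1}\circ\sigma\circ\varphi_0$, and $\sigma$ is called $\varphi$-invariant at $x$ if $\varphi^*\sigma|_{p_0^{-1}(x)}=\sigma|_{p_0^{-1}(x)}$.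 Proposition. Let $\varphi$, defined over $U\subset M$, cover a symmetry with the center at $x\in U$ on a $|1|$-graded geometry. Then: 1. There is a (global) Weyl structure $\sigma$ which is $\varphi$-invariant at $x$. 2. For every Weyl structure $\hat\sigma$, the pullback $\varphi^*\hat\sigma$ is a Weyl structure over $U$, there is exactly one $1$-form $\Upsilon$ over $U$ such that $\varphi^*\hat\sigma=\hat\sigma+\Upsilon$ over $U$, and $\hat\sigma+\frac12\Upsilon$ is a Weyl structure over $U$ which is $\varphi$-invariant at $x$. 3. All $\varphi$-invariant Weyl structures at $x$ coincide at $x$: if $\sigma$ and $\bar\sigma$ are Weyl structures over open neighborhoods of $x$ which are both $\varphi$-invariant at $x$, then $\sigma=\bar\sigma$ on $p_0^{-1}(x)$. -/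

import Mathlib

open Set Function
open scoped Manifold ContDiff

noncomputable section

namespace WeylSym

/-! ### Lie groups: adjoint action and exponential map -/

section LieGroups

variable {n : ℕ} {G : Type*} [TopologicalSpace G] [ChartedSpace (EuclideanSpace ℝ (Fin n)) G]
  [Group G]

/-- An element of the Lie algebra of `G`, read in the model vector space `ℝⁿ`
(the tangent space at a point of a manifold modelled on `ℝⁿ` is, as a vector space, `ℝⁿ`).
It is used only to speak of smooth functions with values in the Lie algebra. -/
def toModel (X : GroupLieAlgebra (𝓡 n) G) : EuclideanSpace ℝ (Fin n) := X

/-- The adjoint action of `g` on the Lie algebra: the derivative at the identity of the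
conjugation `h ↦ g h g⁻¹`. (The point `g * 1 * g⁻¹` at which the derivative takes its values is
the identity, and all tangent spaces are the model space, so no transport is needed.) -/
def Ad (g : G) : GroupLieAlgebra (𝓡 n) G →L[ℝ] GroupLieAlgebra (𝓡 n) G :=
  mfderiv (𝓡 n) (𝓡 n) (fun h : G => g * h * g⁻¹) 1

open Classical in
/-- The exponential map: `exp X = γ 1`, where `γ : ℝ → G` is the integral curve through the
identity of the left invariant vector field generated by `X`. -/
def lieExp (X : GroupLieAlgebra (𝓡 n) G) : G :=
  if h : ∃ γ : ℝ → G, γ 0 = 1 ∧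
      IsMIntegralCurve (I := 𝓡 n) γ (fun g : G => mulInvariantVectorField (I := 𝓡 n) X g)
  then h.choose 1 else 1

open Classical in
/-- The exponential map with values in a subgroup `P`, for those `X` with `exp X ∈ P`. -/
def expIn (P : Subgroup G) (X : GroupLieAlgebra (𝓡 n) G) : P :=
  if h : lieExp X ∈ P then ⟨lieExp X, h⟩ else 1

/-- A smooth Lie group is regular enough for its tangent space at the identity to carry
Mathlib's Lie algebra structure. -/
instance instLieGroupMinSmoothness [LieGroup (𝓡 n) ∞ G] :
    LieGroup (𝓡 n) (minSmoothness ℝ 3) G := by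
  rw [minSmoothness_of_isRCLikeNormedField]
  infer_instance

end LieGroups

/-! ### `|1|`-gradings and parabolic subgroups -/

/-- A `|1|`-grading `𝔤 = 𝔤₋₁ ⊕ 𝔤₀ ⊕ 𝔤₁` of the Lie algebra of `G`, without simple ideals
contained in `𝔤₀`. (For a `|1|`-grading the negative part is `𝔤₋₁`, so that it is generated by
`𝔤₋₁` is automatic.) -/
structure OneGrading {n : ℕ} (G : Type*) [TopologicalSpace G]
    [ChartedSpace (EuclideanSpace ℝ (Fin n)) G] [Group G] [LieGroup (𝓡 n) ∞ G] where
  gr : ℤ → Submodule ℝ (GroupLieAlgebra (𝓡 n) G)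
  isInternal : DirectSum.IsInternal gr
  gr_eq_bot : ∀ i : ℤ, 1 < |i| → gr i = ⊥
  lie_mem : ∀ (i j : ℤ), ∀ X ∈ gr i, ∀ Y ∈ gr j, ⁅X, Y⁆ ∈ gr (i + j)
  not_simple_le : ∀ J : LieIdeal ℝ (GroupLieAlgebra (𝓡 n) G),
    LieAlgebra.IsSimple ℝ J → ¬ (J.toSubmodule ≤ gr 0)

section Parabolic

variable {n : ℕ} {G : Type*} [TopologicalSpace G] [ChartedSpace (EuclideanSpace ℝ (Fin n)) G]
  [Group G] [LieGroup (𝓡 n) ∞ G]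

/-- The filtration `𝔤ⁱ = 𝔤ᵢ ⊕ 𝔤ᵢ₊₁ ⊕ ⋯`. -/
def OneGrading.filt (𝔤 : OneGrading (n := n) G) (i : ℤ) :
    Submodule ℝ (GroupLieAlgebra (𝓡 n) G) :=
  ⨆ j : {j : ℤ // i ≤ j}, 𝔤.gr j

/-- The largest possible `P`: elements whose adjoint action preserves the filtration. -/
def OneGrading.maxP (𝔤 : OneGrading (n := n) G) : Set G :=
  {g | ∀ i : ℤ, ∀ X ∈ 𝔤.filt i, Ad g X ∈ 𝔤.filt i}

/-- The largest possible `G₀`: elements whose adjoint action preserves the grading. -/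
def OneGrading.maxG0 (𝔤 : OneGrading (n := n) G) : Set G :=
  {g | ∀ i : ℤ, ∀ X ∈ 𝔤.gr i, Ad g X ∈ 𝔤.gr i}

variable {k : ℕ}

/-- `P` is a Lie subgroup of `G` with Lie algebra `𝔭 = 𝔤⁰ = 𝔤₀ ⊕ 𝔤₁`, which lies between the
group of all elements preserving the filtration and the identity component of that group. -/
structure IsParabolic (𝔤 : OneGrading (n := n) G) (P : Subgroup G)
    [ChartedSpace (EuclideanSpace ℝ (Fin k)) P] : Prop where
  isSmoothEmbedding :
    Manifold.IsSmoothEmbedding (𝓡 k) (𝓡 n) ∞ (Subtype.val : P → G)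
  lieAlgebra_eq :
    range (mfderiv (𝓡 k) (𝓡 n) (Subtype.val : P → G) (1 : P)) = (𝔤.filt 0 : Set _)
  subset_maxP : (P : Set G) ⊆ 𝔤.maxP
  component_subset : connectedComponentIn 𝔤.maxP 1 ⊆ (P : Set G)

/-- The subgroup `G₀` of `P`: the elements of `P` whose adjoint action preserves the grading. -/
def OneGrading.G0 (𝔤 : OneGrading (n := n) G) (P : Subgroup G) : Set P :=
  {h | (h : G) ∈ 𝔤.maxG0}

end Parabolic

/-! ### Cartan geometries -/

/-- A smooth principal bundle `proj : B → M` with structure group `P`; `act u h` is the right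
action `u · h`. -/
structure PrincipalBundle {b k m : ℕ}
    (P : Type*) [TopologicalSpace P] [ChartedSpace (EuclideanSpace ℝ (Fin k)) P] [Group P]
    (B : Type*) [TopologicalSpace B] [ChartedSpace (EuclideanSpace ℝ (Fin b)) B]
    (M : Type*) [TopologicalSpace M] [ChartedSpace (EuclideanSpace ℝ (Fin m)) M] where
  proj : B → M
  act : B → P → B
  act_one : ∀ u, act u 1 = u
  act_mul : ∀ u g h, act u (g * h) = act (act u g) h
  proj_act : ∀ u h, proj (act u h) = proj u
  contMDiff_proj : ContMDiff (𝓡 b) (𝓡 m) ∞ proj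
  contMDiff_act :
    ContMDiff ((𝓡 b).prod (𝓡 k)) (𝓡 b) ∞ (fun q : B × P => act q.1 q.2)
  /-- Around each point of `M` there is an equivariant diffeomorphism `U × P ≅ proj⁻¹ U` over
  `U`. -/
  locally_trivial : ∀ x : M, ∃ (U : Set M) (e : OpenPartialHomeomorph (M × P) B),
    IsOpen U ∧ x ∈ U ∧ e.source = U ×ˢ univ ∧ e.target = proj ⁻¹' U ∧
    ContMDiffOn ((𝓡 m).prod (𝓡 k)) (𝓡 b) ∞ e e.source ∧
    ContMDiffOn (𝓡 b) ((𝓡 m).prod (𝓡 k)) ∞ e.symm e.target ∧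
    ∀ y ∈ U, ∀ g : P, proj (e (y, g)) = y ∧ ∀ h : P, e (y, g * h) = act (e (y, g)) h

/-- A Cartan geometry of type `(G, P)` on `M`: a principal `P`-bundle `B → M` with a Cartan
connection `conn`, written `ω` below. -/
structure CartanGeometry {n k m : ℕ}
    {G : Type*} [TopologicalSpace G] [ChartedSpace (EuclideanSpace ℝ (Fin n)) G] [Group G]
    (P : Subgroup G) [ChartedSpace (EuclideanSpace ℝ (Fin k)) P]
    (B : Type*) [TopologicalSpace B] [ChartedSpace (EuclideanSpace ℝ (Fin n)) B]
    [IsManifold (𝓡 n) ∞ B]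
    (M : Type*) [TopologicalSpace M] [ChartedSpace (EuclideanSpace ℝ (Fin m)) M]
    extends PrincipalBundle (b := n) (k := k) (m := m) P B M where
  conn : ∀ u : B, TangentSpace (𝓡 n) u →L[ℝ] GroupLieAlgebra (𝓡 n) G
  /-- `ω` is a smooth `1`-form: a smooth function on the tangent bundle. -/
  contMDiff_conn : ContMDiff (𝓡 n).tangent (𝓡 n) ∞
    (fun v : TangentBundle (𝓡 n) B => toModel (conn v.proj v.2))
  /-- `(r^h)^* ω = Ad (h⁻¹) ∘ ω`. -/
  equivariant : ∀ (h : P) (u : B) (v : TangentSpace (𝓡 n) u),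
    conn (act u h) (mfderiv (𝓡 n) (𝓡 n) (fun u' => act u' h) u v) = Ad ((h : G)⁻¹) (conn u v)
  /-- `ω` reproduces the generators of fundamental vector fields: the fundamental vector field
  of `X` in the Lie algebra of `P` at `u` is the image of `X` under the derivative at the
  identity of `h ↦ u · h`, and `X` is viewed in `𝔤` through the inclusion of `P` in `G`. -/
  fundamental : ∀ (u : B) (X : GroupLieAlgebra (𝓡 k) P),
    conn (act u 1) (mfderiv (𝓡 k) (𝓡 n) (fun h : P => act u h) 1 X) =
      mfderiv (𝓡 k) (𝓡 n) (Subtype.val : P → G) (1 : P) X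
  bijective : ∀ u : B, Bijective (conn u)

section Geometry

variable {n k m : ℕ}
  {G : Type*} [TopologicalSpace G] [ChartedSpace (EuclideanSpace ℝ (Fin n)) G] [Group G]
  {P : Subgroup G} [ChartedSpace (EuclideanSpace ℝ (Fin k)) P]
  {B : Type*} [TopologicalSpace B] [ChartedSpace (EuclideanSpace ℝ (Fin n)) B]
  [IsManifold (𝓡 n) ∞ B]
  {M : Type*} [TopologicalSpace M] [ChartedSpace (EuclideanSpace ℝ (Fin m)) M]

/-- A (local) automorphism of a Cartan geometry: a `P`-equivariant diffeomorphism
`φ : proj⁻¹ U → proj⁻¹ V` which covers a diffeomorphism `base : U → V` between open subsets of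
`M` and preserves the Cartan connection. Global automorphisms are the case `U = V = M`. -/
structure LocalAut (C : CartanGeometry (n := n) (k := k) (m := m) P B M) where
  φ : OpenPartialHomeomorph B B
  base : OpenPartialHomeomorph M M
  source_eq : φ.source = C.proj ⁻¹' base.source
  target_eq : φ.target = C.proj ⁻¹' base.target
  contMDiffOn_φ : ContMDiffOn (𝓡 n) (𝓡 n) ∞ φ φ.source
  contMDiffOn_φ_symm : ContMDiffOn (𝓡 n) (𝓡 n) ∞ φ.symm φ.target
  contMDiffOn_base : ContMDiffOn (𝓡 m) (𝓡 m) ∞ base base.source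
  contMDiffOn_base_symm : ContMDiffOn (𝓡 m) (𝓡 m) ∞ base.symm base.target
  covers : ∀ u ∈ φ.source, C.proj (φ u) = base (C.proj u)
  map_act : ∀ u ∈ φ.source, ∀ h : P, φ (C.act u h) = C.act (φ u) h
  preserves_conn : ∀ u ∈ φ.source, ∀ v : TangentSpace (𝓡 n) u,
    C.conn (φ u) (mfderiv (𝓡 n) (𝓡 n) φ u v) = C.conn u v

/-- The base map of `Φ` is a (local) symmetry with centre `x`: it fixes `x` and its tangent map
at `x` is `-id`. (For a `|1|`-graded geometry the filtration of the tangent bundle is trivial.) -/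
def LocalAut.CoversSymmetryAt {C : CartanGeometry (n := n) (k := k) (m := m) P B M}
    (Φ : LocalAut C) (x : M) : Prop :=
  x ∈ Φ.base.source ∧ Φ.base x = x ∧
    ∀ v : TangentSpace (𝓡 m) x,
      tangentMap (𝓡 m) (𝓡 m) Φ.base (⟨x, v⟩ : TangentBundle (𝓡 m) M) = ⟨x, -v⟩

variable [LieGroup (𝓡 n) ∞ G]

/-! ### The underlying bundle and Weyl structures -/

/-- `u` and `v` lie in the same orbit of `P₊ = exp 𝔤₁`. -/
def PlusRel (𝔤 : OneGrading (n := n) G) (C : CartanGeometry (n := n) (k := k) (m := m) P B M)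
    (u v : B) : Prop :=
  ∃ Z ∈ 𝔤.gr 1, v = C.act u (expIn P Z)

/-- The underlying bundle `B₀ = B / exp 𝔤₁`. Its smooth structure is the quotient one: a map on
(an open part of) `B₀` is smooth if and only if its composition with `B → B₀` is smooth; its
`G₀`-action is the one induced from `B`. Both are spelled out where they are used. -/
def Under (𝔤 : OneGrading (n := n) G) (C : CartanGeometry (n := n) (k := k) (m := m) P B M) :
    Type _ :=
  Quot (PlusRel 𝔤 C)

variable {𝔤 : OneGrading (n := n) G} {C : CartanGeometry (n := n) (k := k) (m := m) P B M}

/-- The projection `π : B → B₀`. -/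
def Under.mk (𝔤 : OneGrading (n := n) G) (C : CartanGeometry (n := n) (k := k) (m := m) P B M)
    (u : B) : Under 𝔤 C :=
  Quot.mk _ u

/-- The projection `p₀ : B₀ → M`. -/
def Under.proj (q : Under 𝔤 C) : M :=
  Quot.lift C.proj (by rintro u v ⟨Z, -, rfl⟩; exact (C.proj_act _ _).symm) q

/-- The map `φ₀` induced by `φ` on the part of `B₀` over the domain of the base map; see
`underMap_mk` for the independence of the representative. -/
def LocalAut.underMap (Φ : LocalAut C) (q : Under 𝔤 C) : Under 𝔤 C :=
  Under.mk 𝔤 C (Φ.φ (Quot.out q))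

theorem LocalAut.underMap_mk (Φ : LocalAut C) {u : B} (hu : u ∈ Φ.φ.source) :
    Φ.underMap (Under.mk 𝔤 C u) = Under.mk 𝔤 C (Φ.φ u) := by
  have key : ∀ a b : B, Relation.EqvGen (PlusRel 𝔤 C) a b →
      (a ∈ Φ.φ.source ↔ b ∈ Φ.φ.source) ∧
      (a ∈ Φ.φ.source → Under.mk 𝔤 C (Φ.φ a) = Under.mk 𝔤 C (Φ.φ b)) := by
    intro a b h
    induction h with
    | rel a b h =>
      obtain ⟨Z, hZ, rfl⟩ := h
      refine ⟨by simp [Φ.source_eq, C.proj_act], fun ha => ?_⟩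
      rw [Φ.map_act a ha]
      exact Quot.sound ⟨Z, hZ, rfl⟩
    | refl a => exact ⟨Iff.rfl, fun _ => rfl⟩
    | symm a b _ ih => exact ⟨ih.1.symm, fun hb => (ih.2 (ih.1.2 hb)).symm⟩
    | trans a b c _ _ ih1 ih2 =>
      exact ⟨ih1.1.trans ih2.1, fun ha => (ih1.2 ha).trans (ih2.2 (ih1.1.1 ha))⟩
  have h1 : Relation.EqvGen (PlusRel 𝔤 C) u (Quot.out (Under.mk 𝔤 C u)) :=
    Quot.eqvGen_exact (Quot.out_eq (Under.mk 𝔤 C u)).symm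
  exact ((key _ _ h1).2 hu).symm

/-- `σ` is a Weyl structure over the open set `U ⊆ M`: a smooth `G₀`-equivariant section of
`B → B₀` over the part of `B₀` which lies over `U` (values elsewhere are irrelevant). A Weyl
structure in the global sense is the case `U = M`. -/
structure IsWeylOn (U : Set M) (σ : Under 𝔤 C → B) : Prop where
  isSection : ∀ q : Under 𝔤 C, q.proj ∈ U → Under.mk 𝔤 C (σ q) = q
  equivariant : ∀ u : B, C.proj u ∈ U → ∀ h ∈ 𝔤.G0 P,
    σ (Under.mk 𝔤 C (C.act u h)) = C.act (σ (Under.mk 𝔤 C u)) h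
  smooth : ContMDiffOn (𝓡 n) (𝓡 n) ∞ (fun u : B => σ (Under.mk 𝔤 C u)) (C.proj ⁻¹' U)

/-- `Υ` is a `1`-form over the open set `U ⊆ M`: a smooth `G₀`-equivariant function with values
in `𝔤₁` on the part of `B₀` which lies over `U`. -/
structure IsOneFormOn (U : Set M) (Υ : Under 𝔤 C → GroupLieAlgebra (𝓡 n) G) : Prop where
  mem : ∀ q : Under 𝔤 C, q.proj ∈ U → Υ q ∈ 𝔤.gr 1
  equivariant : ∀ u : B, C.proj u ∈ U → ∀ h ∈ 𝔤.G0 P,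
    Υ (Under.mk 𝔤 C (C.act u h)) = Ad ((h : G)⁻¹) (Υ (Under.mk 𝔤 C u))
  smooth : ContMDiffOn (𝓡 n) (𝓡 n) ∞
    (fun u : B => toModel (Υ (Under.mk 𝔤 C u))) (C.proj ⁻¹' U)

/-- `σ + Υ`, the map `q ↦ σ(q) · exp Υ(q)`. -/
def shift (σ : Under 𝔤 C → B) (Υ : Under 𝔤 C → GroupLieAlgebra (𝓡 n) G) : Under 𝔤 C → B :=
  fun q => C.act (σ q) (expIn P (Υ q))

/-- The pullback `φ^* σ = φ⁻¹ ∘ σ ∘ φ₀`, defined over the domain of the base map of `φ`. -/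
def LocalAut.pullback (Φ : LocalAut C) (σ : Under 𝔤 C → B) : Under 𝔤 C → B :=
  fun q => Φ.φ.symm (σ (Φ.underMap q))

/-- `σ` is `φ`-invariant at `x`: `φ^* σ = σ` on the fibre of `B₀` over `x`. -/
def LocalAut.InvariantAt (Φ : LocalAut C) (x : M) (σ : Under 𝔤 C → B) : Prop :=
  ∀ q : Under 𝔤 C, q.proj = x → Φ.pullback σ q = σ q

end Geometry

end WeylSym

end

/-! Weyl structures are replaced by equivariant functions on the total space `B`, which turns the
proposition into affine algebra in `𝔤₁`.

Semisimplicity gives a grading element `E ∈ 𝔤₀` with `ad E = i` on `𝔤ᵢ`, since the derivation with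
these eigenvalues is inner. Inside `P`, the subgroup `G₀` is the stabilizer of `E`
(`IsParabolic.mem_G0_iff`), and `Ad (exp Z) E = E - Z` for `Z ∈ 𝔤₁`, so the `P`-orbit of `E` is the
affine space `E + 𝔤₁`. A Weyl structure, being a reduction to `G₀`, is therefore the same as a
smooth `P`-equivariant `F : B → E + 𝔤₁`; the two are related by `σ (π u) = u · exp (E - F u)`, so
that `F = E` exactly on the image of `σ`. In these terms `φ^* σ` is `F ∘ φ`, `σ + Υ` is `F - Υ`, and
combinations whose coefficients are functions on `M` with sum `1` stay in the class; partitions of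
unity then give global existence.

The symmetry matters only over `x`. There `φ u = u · h`, and comparing `ω` with the projection to
`M` shows that `Ad h` is `-id` on `𝔤/𝔭` (`LocalAut.CoversSymmetryAt.Ad_add_mem`). The Killing form
is nondegenerate and `𝔤₁` is orthogonal to `𝔭`, so `Ad h` is `-id` on `𝔤₁` as well
(`GradingElement.automorphism_eq_neg`). Two consequences follow. First, `F ∘ φ ∘ φ = F` over `x`, so
the average of `F` and `F ∘ φ` is invariant at `x`; with `Υ = F - F ∘ φ` this average is `F - ½ Υ`,
and a bump function makes it global. Secondly, the difference of two functions invariant at `x`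
equals its own negative over `x`, hence vanishes.

The facts about `Ad` and `exp` used here are derived from the definition of the bracket through left
invariant vector fields. -/

noncomputable section

namespace WeylSym

/-! ### Grading elements, filtered automorphisms and the Killing form -/

section Algebra

variable {L : Type*} [LieRing L] [LieAlgebra ℝ L]

/-- A `|1|`-grading of a Lie algebra together with its grading element. -/
structure GradingElement (gr : ℤ → Submodule ℝ L) (E : L) : Prop where
  eq_bot : ∀ i : ℤ, 1 < |i| → gr i = ⊥
  iSup_eq_top : ⨆ i, gr i = ⊤
  lie_mem : ∀ (i j : ℤ), ∀ X ∈ gr i, ∀ Y ∈ gr j, ⁅X, Y⁆ ∈ gr (i + j)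
  lie_eq : ∀ i : ℤ, ∀ X ∈ gr i, ⁅E, X⁆ = (i : ℝ) • X
  mem_zero : E ∈ gr 0

/-- The map acting by `i` on `gr i` is a derivation, and derivations of a semisimple Lie algebra are
inner. -/
theorem exists_gradingElement [FiniteDimensional ℝ L] [LieAlgebra.IsSemisimple ℝ L]
    {gr : ℤ → Submodule ℝ L} (hint : DirectSum.IsInternal gr)
    (hbot : ∀ i : ℤ, 1 < |i| → gr i = ⊥)
    (hlie : ∀ (i j : ℤ), ∀ X ∈ gr i, ∀ Y ∈ gr j, ⁅X, Y⁆ ∈ gr (i + j)) :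
    ∃ E, GradingElement gr E := by
  classical
  have htop := hint.submodule_iSup_eq_top
  let e := LinearEquiv.ofBijective (DirectSum.coeLinearMap gr) hint
  let D : L →ₗ[ℝ] L :=
    (DirectSum.toModule ℝ ℤ L (fun i => (i : ℝ) • (gr i).subtype)) ∘ₗ e.symm.toLinearMap
  have hD : ∀ i : ℤ, ∀ X ∈ gr i, D X = (i : ℝ) • X := by
    intro i X hX
    have : e.symm X = DirectSum.lof ℝ ℤ (fun i => gr i) i ⟨X, hX⟩ := by
      rw [LinearEquiv.symm_apply_eq]
      exact (DirectSum.coeLinearMap_lof gr i ⟨X, hX⟩).symm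
    simp [D, this]
  have hder : ∀ X Y : L, D ⁅X, Y⁆ = ⁅X, D Y⁆ - ⁅Y, D X⁆ := by
    intro X Y
    have hX : X ∈ ⨆ i, gr i := htop ▸ Submodule.mem_top
    have hY : Y ∈ ⨆ i, gr i := htop ▸ Submodule.mem_top
    induction hX using Submodule.iSup_induction' with
    | zero => simp
    | add X X' _ _ h h' => simp only [add_lie, map_add, lie_add, h, h']; abel
    | mem i X hX =>
      induction hY using Submodule.iSup_induction' with
      | zero => simp
      | add Y Y' _ _ h h' => simp only [add_lie, map_add, lie_add, h, h']; abel
      | mem j Y hY =>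
        rw [hD _ _ (hlie i j X hX Y hY), hD _ _ hX, hD _ _ hY, lie_smul, lie_smul,
          ← lie_skew Y X]
        push_cast
        module
  let δ : LieDerivation ℝ L L := ⟨D, hder⟩
  obtain ⟨E, hE⟩ : ∃ E : L, LieDerivation.ad ℝ L E = δ := by
    have h := LieDerivation.IsKilling.range_ad_eq_top ℝ L
    exact (LieHom.range_eq_top _).1 h δ
  have hE' : ∀ X, ⁅E, X⁆ = D X := fun X => by
    have := congrArg (fun d : LieDerivation ℝ L L => d X) hE
    simpa [δ] using this
  have hlieE : ∀ i : ℤ, ∀ X ∈ gr i, ⁅E, X⁆ = (i : ℝ) • X := fun i X hX => by rw [hE', hD i X hX]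
  refine ⟨E, hbot, htop, hlie, hlieE, ?_⟩
  -- `1 - D²` kills degrees `±1` and fixes degree `0`. Applied to `E` it returns `E`, because `D E =
  -- ⁅E, E⁆ = 0`.
  have key : ∀ X : L, X - D (D X) ∈ gr 0 := by
    intro X
    have hX : X ∈ ⨆ i, gr i := htop ▸ Submodule.mem_top
    induction hX using Submodule.iSup_induction' with
    | zero => simp
    | add X X' _ _ h h' =>
      have : X + X' - D (D (X + X')) = (X - D (D X)) + (X' - D (D X')) := by
        simp only [map_add]; abel
      rw [this]; exact add_mem h h'
    | mem i X hX =>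
      rw [hD _ _ hX, map_smul, hD _ _ hX]
      by_cases hi : 1 < |i|
      · have : X = 0 := by simpa [hbot i hi] using hX
        simp [this]
      · have : i = 0 ∨ i = 1 ∨ i = -1 := by
          rw [not_lt, abs_le] at hi; omega
        rcases this with rfl | rfl | rfl
        · simpa using hX
        · simp
        · simp
  have h0 : D E = 0 := by rw [← hE', lie_self]
  simpa [h0] using key E

namespace GradingElement

variable {gr : ℤ → Submodule ℝ L} {E : L} (h : GradingElement gr E)
include h

theorem induction {p : L → Prop} (h0 : p 0) (hadd : ∀ X Y, p X → p Y → p (X + Y))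
    (hm : ∀ X ∈ gr (-1), p X) (hz : ∀ X ∈ gr 0, p X) (hp : ∀ X ∈ gr 1, p X) (X : L) : p X := by
  have hX : X ∈ ⨆ i, gr i := h.iSup_eq_top ▸ Submodule.mem_top
  induction hX using Submodule.iSup_induction' with
  | zero => exact h0
  | add X X' _ _ h h' => exact hadd _ _ h h'
  | mem i X hX =>
    by_cases hi : 1 < |i|
    · have : X = 0 := by simpa [h.eq_bot i hi] using hX
      simpa [this]
    · have : i = 0 ∨ i = 1 ∨ i = -1 := by
        rw [not_lt, abs_le] at hi; omega
      rcases this with rfl | rfl | rfl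
      · exact hz X hX
      · exact hp X hX
      · exact hm X hX

theorem lie_one {X : L} (hX : X ∈ gr 1) : ⁅E, X⁆ = X := by simpa using h.lie_eq 1 X hX
theorem lie_zero {X : L} (hX : X ∈ gr 0) : ⁅E, X⁆ = 0 := by simpa using h.lie_eq 0 X hX
theorem lie_neg_one {X : L} (hX : X ∈ gr (-1)) : ⁅E, X⁆ = -X := by
  simpa using h.lie_eq (-1) X hX

theorem lie_one_one {X Y : L} (hX : X ∈ gr 1) (hY : Y ∈ gr 1) : ⁅X, Y⁆ = 0 := by
  have := h.lie_mem 1 1 X hX Y hY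
  rw [h.eq_bot (1 + 1) (by norm_num)] at this
  simpa using this

theorem exists_decomposition (X : L) :
    ∃ a ∈ gr (-1), ∃ b ∈ gr 0, ∃ c ∈ gr 1, X = a + b + c := by
  induction X using h.induction with
  | h0 => exact ⟨0, zero_mem _, 0, zero_mem _, 0, zero_mem _, by simp⟩
  | hadd X Y hX hY =>
    obtain ⟨a, ha, b, hb, c, hc, rfl⟩ := hX
    obtain ⟨a', ha', b', hb', c', hc', rfl⟩ := hY
    exact ⟨a + a', add_mem ha ha', b + b', add_mem hb hb', c + c', add_mem hc hc', by abel⟩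
  | hm X hX => exact ⟨X, hX, 0, zero_mem _, 0, zero_mem _, by simp⟩
  | hz X hX => exact ⟨0, zero_mem _, X, hX, 0, zero_mem _, by simp⟩
  | hp X hX => exact ⟨0, zero_mem _, 0, zero_mem _, X, hX, by simp⟩

/-- `ad E` is diagonalizable, so its eigenspaces are no larger than the graded pieces. This reduces
preserving the grading to fixing `E`. -/
theorem mem_iff (i : ℤ) (X : L) : X ∈ gr i ↔ ⁅E, X⁆ = (i : ℝ) • X := by
  refine ⟨h.lie_eq i X, fun hX => ?_⟩
  obtain ⟨a, ha, b, hb, c, hc, rfl⟩ := h.exists_decomposition X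
  have h1 : ⁅E, a + b + c⁆ = c - a := by
    rw [lie_add, lie_add, h.lie_one hc, h.lie_zero hb, h.lie_neg_one ha]; abel
  have h2 : ⁅E, c - a⁆ = c + a := by
    rw [lie_sub, h.lie_one hc, h.lie_neg_one ha]; abel
  have h3 : ⁅E, c + a⁆ = c - a := by
    rw [lie_add, h.lie_one hc, h.lie_neg_one ha]; abel
  -- `ad E` exchanges `c + a` and `c - a`, so the eigenvalue equation gives `c + a = i² (c + a)`.
  -- Apart from `i = 0, ±1` this forces `c + a = 0`.
  have e1 := h1.symm.trans hX
  have e2 : c + a = (i : ℝ) • (c - a) := by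
    rw [← h2, e1, lie_smul, hX]
  have e3 : c - a = (i : ℝ) • (c + a) := by rw [← h3, e2, lie_smul, h2, ← e2]
  have e2c : c + a = ((i : ℝ) * i) • (c + a) := by rw [mul_smul, ← e3, ← e2]
  by_cases hi : i = 0
  · subst hi
    simp only [Int.cast_zero, zero_smul] at e2 e3
    rw [show a + b + c = b + (c + a) by abel, e2]
    simpa using hb
  by_cases hi1 : i = 1
  · subst hi1
    have ha0 : (2 : ℝ) • a = 0 := by
      have : (2 : ℝ) • a = (c + a) - (c - a) := by module
      rw [this, e3]; simp
    have hb0 : b = 0 := by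
      have : b = (((1 : ℤ) : ℝ) • (a + b + c)) - (c - a) - (2 : ℝ) • a := by push_cast; module
      rw [this, ← e1, ha0]; simp
    have ha0' : a = 0 := by simpa using ha0
    simpa [ha0', hb0] using hc
  by_cases hi2 : i = -1
  · subst hi2
    have ha0 : (2 : ℝ) • c = 0 := by
      have : (2 : ℝ) • c = (c + a) + (c - a) := by module
      rw [this, e3]; push_cast; module
    have hb0 : b = 0 := by
      have : b = -(((-1 : ℤ) : ℝ) • (a + b + c)) + (c - a) - (2 : ℝ) • c := by push_cast; module
      rw [this, ← e1, ha0]; simp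
    have ha0' : c = 0 := by simpa using ha0
    simpa [ha0', hb0] using ha
  have hii : ((i : ℝ) * i - 1) ≠ 0 := by
    have : (i - 1) * (i + 1) ≠ 0 := by
      apply mul_ne_zero <;> omega
    have h' : (((i - 1) * (i + 1) : ℤ) : ℝ) ≠ 0 := by exact_mod_cast this
    push_cast at h'
    intro hc; apply h'; linarith
  have e4 : c + a = 0 := by
    have : ((i : ℝ) * i - 1) • (c + a) = 0 := by rw [sub_smul, ← e2c]; simp
    exact (smul_eq_zero.1 this).resolve_left hii
  rw [e4, smul_zero] at e3
  rw [e3] at e1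
  have hi0 : (i : ℝ) ≠ 0 := by exact_mod_cast hi
  have : a + b + c = 0 := by
    rcases smul_eq_zero.1 e1.symm with h | h
    · exact absurd h hi0
    · exact h
  rw [this]; exact zero_mem _

theorem disjoint_of_ne {i j : ℤ} (hij : i ≠ j) {X : L} (hi : X ∈ gr i) (hj : X ∈ gr j) :
    X = 0 := by
  have h1 := (h.lie_eq i X hi).symm.trans (h.lie_eq j X hj)
  have : ((i : ℝ) - j) • X = 0 := by rw [sub_smul, h1, sub_self]
  rcases smul_eq_zero.1 this with h' | h'
  · exact absurd (by exact_mod_cast sub_eq_zero.1 h') hij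
  · exact h'

/-- The nonnegative part of the filtration. -/
theorem mem_nonneg_iff (X : L) : X ∈ (⨆ j : {j : ℤ // 0 ≤ j}, gr j) ↔
    ∃ b ∈ gr 0, ∃ c ∈ gr 1, X = b + c := by
  constructor
  · intro hX
    induction hX using Submodule.iSup_induction' with
    | zero => exact ⟨0, zero_mem _, 0, zero_mem _, by simp⟩
    | add X Y _ _ hX hY =>
      obtain ⟨b, hb, c, hc, rfl⟩ := hX
      obtain ⟨b', hb', c', hc', rfl⟩ := hY
      exact ⟨b + b', add_mem hb hb', c + c', add_mem hc hc', by abel⟩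
    | mem i X hX =>
      obtain ⟨i, hi⟩ := i
      by_cases hi' : 1 < |i|
      · have : X = 0 := by simpa [h.eq_bot i hi'] using hX
        exact ⟨0, zero_mem _, 0, zero_mem _, by simp [this]⟩
      · have : i = 0 ∨ i = 1 := by
          rw [not_lt, abs_le] at hi'; omega
        rcases this with rfl | rfl
        · exact ⟨X, hX, 0, zero_mem _, by simp⟩
        · exact ⟨0, zero_mem _, X, hX, by simp⟩
  · rintro ⟨b, hb, c, hc, rfl⟩
    exact add_mem (Submodule.mem_iSup_of_mem (⟨0, le_rfl⟩ : {j : ℤ // 0 ≤ j}) hb)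
      (Submodule.mem_iSup_of_mem (⟨1, by norm_num⟩ : {j : ℤ // 0 ≤ j}) hc)

theorem pos_eq : (⨆ j : {j : ℤ // 1 ≤ j}, gr j) = gr 1 := by
  apply le_antisymm
  · refine iSup_le ?_
    rintro ⟨j, hj⟩
    by_cases hj' : 1 < |j|
    · simp [h.eq_bot j hj']
    · have : j = 1 := by rw [not_lt, abs_le] at hj'; omega
      simp [this]
  · exact le_iSup (fun j : {j : ℤ // 1 ≤ j} => gr j) ⟨1, le_rfl⟩

/-- `ψ E` acts on `𝔤/𝔭`, `𝔭/𝔤₁` and `𝔤₁` by the same scalars as `E`. Hence the degree `0` part `b`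
of `ψ E` differs from `E` by a central element, and the center is trivial. -/
theorem automorphism_sub_mem [LieAlgebra.IsSemisimple ℝ L] (ψ : L ≃ₗ⁅ℝ⁆ L)
    (h0 : ∀ X ∈ (⨆ j : {j : ℤ // 0 ≤ j}, gr j), ψ X ∈ (⨆ j : {j : ℤ // 0 ≤ j}, gr j))
    (h0' : ∀ X ∈ (⨆ j : {j : ℤ // 0 ≤ j}, gr j), ψ.symm X ∈ (⨆ j : {j : ℤ // 0 ≤ j}, gr j))
    (h1 : ∀ X ∈ gr 1, ψ X ∈ gr 1) (h1' : ∀ X ∈ gr 1, ψ.symm X ∈ gr 1) :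
    ψ E - E ∈ gr 1 := by
  have hmem : ∀ {X : L}, X ∈ gr 0 → X ∈ (⨆ j : {j : ℤ // 0 ≤ j}, gr j) := fun hX =>
    (h.mem_nonneg_iff _).2 ⟨_, hX, 0, zero_mem _, by simp⟩
  have hψ : ∀ X : L, ⁅ψ E, X⁆ = ψ ⁅E, ψ.symm X⁆ := fun X => by
    rw [LieEquiv.map_lie, LieEquiv.apply_symm_apply]
  obtain ⟨b, hb, c, hc, hbc⟩ := (h.mem_nonneg_iff _).1 (h0 E (hmem h.mem_zero))
  -- `ψ E - E = (b - E) + c`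
  have hcen : ∀ X : L, ⁅b - E, X⁆ = 0 := by
    intro X
    induction X using h.induction with
    | h0 => simp
    | hadd X Y hX hY => rw [lie_add, hX, hY, add_zero]
    | hp X hX =>
      have : ⁅ψ E, X⁆ = X := by rw [hψ, h.lie_one (h1' X hX)]; simp
      rw [hbc, add_lie, h.lie_one_one hc hX, add_zero] at this
      rw [sub_lie, this, h.lie_one hX, sub_self]
    | hz X hX =>
      obtain ⟨b', hb', c', hc', e⟩ := (h.mem_nonneg_iff _).1 (h0' X (hmem hX))
      have h2 : ⁅ψ E, X⁆ ∈ gr 1 := by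
        rw [hψ, e, lie_add, h.lie_zero hb', h.lie_one hc', zero_add]
        exact h1 _ hc'
      rw [hbc, add_lie] at h2
      have h3 : ⁅b, X⁆ ∈ gr 1 := by
        have := h.lie_mem 1 0 c hc X hX
        simpa using sub_mem h2 this
      have h4 : ⁅b, X⁆ = 0 := by
        have := h.lie_mem 0 0 b hb X hX
        exact h.disjoint_of_ne (by norm_num) this h3
      rw [sub_lie, h4, h.lie_zero hX, sub_self]
    | hm X hX =>
      obtain ⟨a', ha', b', hb', c', hc', e⟩ := h.exists_decomposition (ψ.symm X)
      have h2 : ⁅ψ E, X⁆ + X ∈ (⨆ j : {j : ℤ // 0 ≤ j}, gr j) := by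
        have : ⁅ψ E, X⁆ + X = ψ (b' + (2 : ℝ) • c') := by
          conv_lhs => rw [hψ, ← ψ.apply_symm_apply X, LieEquiv.symm_apply_apply, ← map_add, e]
          congr 1
          rw [lie_add, lie_add, h.lie_one hc', h.lie_zero hb', h.lie_neg_one ha']
          module
        rw [this]
        exact h0 _ ((h.mem_nonneg_iff _).2 ⟨_, hb', _, (gr 1).smul_mem _ hc', rfl⟩)
      obtain ⟨b₂, hb₂, c₂, hc₂, e₂⟩ := (h.mem_nonneg_iff _).1 h2
      rw [hbc, add_lie] at e₂
      have hcX : ⁅c, X⁆ ∈ gr 0 := by simpa using h.lie_mem 1 (-1) c hc X hX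
      have hbX : ⁅b, X⁆ ∈ gr (-1) := by simpa using h.lie_mem 0 (-1) b hb X hX
      -- `⁅b, X⁆ + X` has degree `-1` and lies in the nonnegative part
      have h5 : ⁅b, X⁆ + X = (b₂ - ⁅c, X⁆) + c₂ := by
        have : ⁅b, X⁆ + X = (⁅b, X⁆ + ⁅c, X⁆ + X) - ⁅c, X⁆ := by abel
        rw [this, e₂]; abel
      have h6 : ⁅E, ⁅b, X⁆ + X⁆ = -(⁅b, X⁆ + X) := h.lie_neg_one (add_mem hbX hX)
      have h7 : ⁅E, ⁅b, X⁆ + X⁆ = c₂ := by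
        rw [h5, lie_add, h.lie_zero (sub_mem hb₂ hcX), h.lie_one hc₂, zero_add]
      have h8 : ⁅b, X⁆ + X ∈ gr 1 := by
        have : ⁅b, X⁆ + X = - c₂ := by rw [← h7, h6, neg_neg]
        rw [this]; exact neg_mem hc₂
      have h9 := h.disjoint_of_ne (by norm_num) (add_mem hbX hX) h8
      rw [sub_lie, h.lie_neg_one hX, sub_neg_eq_add, h9]
  have hb0 : b - E = 0 := by
    have : b - E ∈ LieAlgebra.center ℝ L := by
      rw [LieModule.mem_maxTrivSubmodule]
      intro X
      rw [← lie_skew, hcen, neg_zero]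
    rw [LieAlgebra.center_eq_bot] at this
    simpa using this
  rw [hbc, show b + c - E = (b - E) + c by abel, hb0, zero_add]
  exact hc

/-- Invariance of the form under `ad E` forces orthogonality of degrees whose sum is not `0`. -/
theorem killingForm_one_nonneg [FiniteDimensional ℝ L] {Z X : L} (hZ : Z ∈ gr 1)
    (hX : X ∈ (⨆ j : {j : ℤ // 0 ≤ j}, gr j)) : killingForm ℝ L Z X = 0 := by
  obtain ⟨b, hb, c, hc, rfl⟩ := (h.mem_nonneg_iff _).1 hX
  have key : ∀ Y Y', killingForm ℝ L ⁅E, Y⁆ Y' = - killingForm ℝ L Y ⁅E, Y'⁆ := fun Y Y' => by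
    rw [← LieModule.traceForm_apply_lie_apply, ← lie_skew Y E, LinearMap.map_neg,
      LinearMap.neg_apply, neg_neg]
  have e1 := key Z b
  have e2 := key Z c
  rw [h.lie_one hZ, h.lie_zero hb] at e1
  rw [h.lie_one hZ, h.lie_one hc] at e2
  rw [map_add, e1]
  simp only [map_zero, neg_zero, zero_add]
  linarith

/-- The Killing form is invariant under `ψ` and nondegenerate, and it pairs `𝔤₁` with `𝔤/𝔭`; so
`-id` on `𝔤/𝔭` dualizes to `-id` on `𝔤₁`. -/
theorem automorphism_eq_neg [FiniteDimensional ℝ L] [LieAlgebra.IsSemisimple ℝ L] (ψ : L ≃ₗ⁅ℝ⁆ L)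
    (hψ : ∀ X, ψ X + X ∈ (⨆ j : {j : ℤ // 0 ≤ j}, gr j)) {Z : L} (hZ : Z ∈ gr 1) :
    ψ Z = -Z := by
  have : ψ Z + Z = 0 := by
    have hk := LieAlgebra.IsKilling.ker_killingForm_eq_bot ℝ L
    rw [← LinearMap.ker_eq_bot.1 hk |>.eq_iff, map_zero]
    ext X
    have e : killingForm ℝ L (ψ Z) X = killingForm ℝ L Z (ψ.symm X) := by
      rw [← LieAlgebra.killingForm_of_equiv_apply ψ Z (ψ.symm X), LieEquiv.apply_symm_apply]
    have : killingForm ℝ L Z (ψ (ψ.symm X) + ψ.symm X) = 0 :=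
      h.killingForm_one_nonneg hZ (hψ _)
    rw [map_add, LieEquiv.apply_symm_apply] at this
    simp only [map_add, LinearMap.add_apply, e, LinearMap.zero_apply]
    linarith
  exact eq_neg_of_add_eq_zero_left this

end GradingElement

end Algebra

end WeylSym

namespace WeylSym

open Filter Topology VectorField

/-! ### Calculus in a vector space: local groups and autonomous equations -/

section VectorSpace

variable {V : Type*} [NormedAddCommGroup V] [NormedSpace ℝ V]

/-- In a local group chart with multiplication `μ` and identity `e`, the bracket of left invariant
vector fields is the derivative of the adjoint action `A`. -/
theorem lieBracket_eq_fderiv_of_local_group {μ : V × V → V} {e : V} (hμ : ContDiffAt ℝ 2 μ (e, e))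
    {A : V → V} (hA : DifferentiableAt ℝ A e) {X Y : V} (hAe : A e = Y)
    (hr : ∀ Z, fderiv ℝ μ (e, e) (Z, 0) = Z) (hl : ∀ Z, fderiv ℝ μ (e, e) (0, Z) = Z)
    (hAY : ∀ᶠ a in 𝓝 e, fderiv ℝ μ (e, a) (A a, 0) = fderiv ℝ μ (a, e) (0, Y)) :
    lieBracket ℝ (fun a => fderiv ℝ μ (a, e) (0, X)) (fun a => fderiv ℝ μ (a, e) (0, Y)) e =
      fderiv ℝ A e X := by
  have hd : DifferentiableAt ℝ (fderiv ℝ μ) (e, e) :=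
    (hμ.fderiv_right (m := 1) (by norm_num)).differentiableAt (by norm_num)
  have hsymm : IsSymmSndFDerivAt ℝ μ (e, e) :=
    hμ.isSymmSndFDerivAt (by rw [minSmoothness_of_isRCLikeNormedField])
  set D := fderiv ℝ (fderiv ℝ μ) (e, e) with hD
  have hD' : HasFDerivAt (fderiv ℝ μ) D (e, e) := hd.hasFDerivAt
  have hfield : ∀ Z, HasFDerivAt (fun a => fderiv ℝ μ (a, e) (0, Z))
      ((ContinuousLinearMap.apply ℝ V ((0, Z) : V × V)).comp
        (D.comp (ContinuousLinearMap.inl ℝ V V))) e := by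
    intro Z
    have h1 : HasFDerivAt (fun a : V => (a, e)) (ContinuousLinearMap.inl ℝ V V) e :=
      (hasFDerivAt_id e).prodMk (hasFDerivAt_const e e)
    exact (ContinuousLinearMap.apply ℝ V ((0, Z) : V × V)).hasFDerivAt.comp e
      (HasFDerivAt.comp (g := fderiv ℝ μ) (f := fun a : V => (a, e)) e hD' h1)
  have h2 : HasFDerivAt (fun a : V => (e, a)) (ContinuousLinearMap.inr ℝ V V) e :=
    (hasFDerivAt_const e e).prodMk (hasFDerivAt_id e)
  have h3 : HasFDerivAt (fun a => fderiv ℝ μ (e, a)) (D.comp (ContinuousLinearMap.inr ℝ V V)) e :=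
    HasFDerivAt.comp (g := fderiv ℝ μ) (f := fun a : V => (e, a)) e hD' h2
  have h4 : HasFDerivAt (fun a => (A a, (0 : V)))
      ((ContinuousLinearMap.inl ℝ V V).comp (fderiv ℝ A e)) e :=
    hA.hasFDerivAt.prodMk (hasFDerivAt_const (0 : V) e)
  -- Differentiating `hAY` at `e` along `X` gives `D (0, X) (Y, 0) + A' X = D (X, 0) (0, Y)`. By
  -- symmetry of `D`, solving for `A' X` produces the bracket.
  have h5 := (h3.clm_apply h4).unique ((hfield Y).congr_of_eventuallyEq hAY)
  have h6 := congrArg (fun T => T X) h5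
  simp only [ContinuousLinearMap.comp_apply, add_apply,
    ContinuousLinearMap.flip_apply, ContinuousLinearMap.inl_apply, ContinuousLinearMap.inr_apply,
    ContinuousLinearMap.apply_apply, hr, hAe] at h6
  simp only [lieBracket, (hfield X).fderiv, (hfield Y).fderiv, hl]
  simp only [ContinuousLinearMap.comp_apply, ContinuousLinearMap.inl_apply,
    ContinuousLinearMap.apply_apply]
  rw [← h6, hsymm.eq (Y, 0) (0, X)]
  exact add_sub_cancel_right _ _

/-- Solutions of autonomous smooth ordinary differential equations are smooth. -/
theorem contDiffAt_of_hasDerivAt {f : ℝ → V} {W : V → V} {t₀ : ℝ}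
    (hW : ContDiffAt ℝ ∞ W (f t₀)) (hf : ∀ᶠ t in 𝓝 t₀, HasDerivAt f (W (f t)) t) :
    ContDiffAt ℝ ∞ f t₀ := by
  rw [contDiffAt_infty]
  -- The order is fixed first, since the neighbourhood on which `W` is `C^n` may depend on `n`. On
  -- the resulting `u`, each use of `f' = W ∘ f` gains one derivative.
  intro n
  obtain ⟨s, hs, hWs⟩ := hW.contDiffOn (m := n) (by exact_mod_cast le_top) (by simp)
  obtain ⟨s', hs's, hs'o, hs't⟩ := mem_nhds_iff.1 hs
  have hc : ContinuousAt f t₀ := hf.self_of_nhds.continuousAt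
  have hev : ∀ᶠ t in 𝓝 t₀, HasDerivAt f (W (f t)) t ∧ f t ∈ s' :=
    hf.and (hc.preimage_mem_nhds (hs'o.mem_nhds hs't))
  obtain ⟨u, hu, huo, hut⟩ := mem_nhds_iff.1 hev
  have key : ∀ k : ℕ, k ≤ n → ContDiffOn ℝ k f u := by
    intro k
    induction k with
    | zero =>
      intro _
      exact contDiffOn_zero.2 fun t ht => (hu ht).1.continuousAt.continuousWithinAt
    | succ k ih =>
      intro hk
      have := ih (by omega)
      push_cast
      rw [contDiffOn_succ_iff_deriv_of_isOpen huo]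
      refine ⟨fun t ht => (hu ht).1.differentiableAt.differentiableWithinAt, by simp, ?_⟩
      have h1 : ContDiffOn ℝ k (W ∘ f) u :=
        ((hWs.mono hs's).of_le (by exact_mod_cast (by omega : k ≤ n))).comp this
          (fun t ht => (hu ht).2)
      exact h1.congr fun t ht => (hu ht).1.deriv
  exact (key n le_rfl).contDiffAt (huo.mem_nhds hut)

end VectorSpace

/-! ### Derivatives of maps between manifolds, read in the model spaces -/

/-- The model vector space `ℝᵈ`. -/
abbrev Eu (d : ℕ) : Type := EuclideanSpace ℝ (Fin d)

section ModelDerivative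

variable {a b c : ℕ} {M₁ M₂ M₃ : Type*} [TopologicalSpace M₁] [ChartedSpace (Eu a) M₁]
  [TopologicalSpace M₂] [ChartedSpace (Eu b) M₂] [TopologicalSpace M₃] [ChartedSpace (Eu c) M₃]

/-- The derivative of a map between manifolds as a map between model spaces. -/
def modelDeriv (a b : ℕ) {M₁ M₂ : Type*} [TopologicalSpace M₁] [ChartedSpace (Eu a) M₁]
    [TopologicalSpace M₂] [ChartedSpace (Eu b) M₂] (f : M₁ → M₂) (x : M₁) : Eu a →L[ℝ] Eu b := mfderiv (𝓡 a) (𝓡 b) f x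

/-- The point `y` is kept apart from `f x` so that identities such as `g * 1 * g⁻¹ = 1` can be fed
in without transport between tangent spaces. -/
theorem modelDeriv_comp {g : M₂ → M₃} {f : M₁ → M₂} {x : M₁} {y : M₂}
    (hg : MDifferentiableAt (𝓡 b) (𝓡 c) g y) (hf : MDifferentiableAt (𝓡 a) (𝓡 b) f x)
    (hy : f x = y) :
    modelDeriv a c (g ∘ f) x = (modelDeriv b c g y).comp (modelDeriv a b f x) := by
  subst hy
  exact mfderiv_comp x hg hf

theorem modelDeriv_id (x : M₁) : modelDeriv a a (id : M₁ → M₁) x = ContinuousLinearMap.id ℝ (Eu a) :=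
  mfderiv_id

theorem modelDeriv_congr {f g : M₁ → M₂} {x : M₁} (h : f =ᶠ[𝓝 x] g) :
    modelDeriv a b f x = modelDeriv a b g x := by
  have := h.mfderiv_eq (I := 𝓡 a) (I' := 𝓡 b)
  exact this

end ModelDerivative

/-! ### The adjoint representation and the multiplication in a chart -/

section GroupChart

variable {d : ℕ} {H : Type*} [TopologicalSpace H] [ChartedSpace (EuclideanSpace ℝ (Fin d)) H]
  [Group H]

theorem Ad_eq_modelDeriv (g : H) : Ad (n := d) g = modelDeriv d d (fun h : H => g * h * g⁻¹) 1 := rfl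

variable [LieGroup (𝓡 d) ∞ H]

theorem mdifferentiableAt_mul_left (g h : H) :
    MDifferentiableAt (𝓡 d) (𝓡 d) (g * ·) h :=
  (contMDiff_mul_left (I := 𝓡 d) (n := ∞)).mdifferentiableAt (by simp)

theorem mdifferentiableAt_mul_right (g h : H) :
    MDifferentiableAt (𝓡 d) (𝓡 d) (· * g) h :=
  (contMDiff_mul_right (I := 𝓡 d) (n := ∞)).mdifferentiableAt (by simp)

theorem contMDiff_conj (g : H) : ContMDiff (𝓡 d) (𝓡 d) ∞ (fun h : H => g * h * g⁻¹) :=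
  (contMDiff_mul_right (I := 𝓡 d) (n := ∞) (a := g⁻¹)).comp
    (contMDiff_mul_left (I := 𝓡 d) (n := ∞) (a := g))

omit [LieGroup (𝓡 d) ∞ H] in
theorem Ad_one : Ad (1 : H) = ContinuousLinearMap.id ℝ (GroupLieAlgebra (𝓡 d) H) := by
  rw [Ad_eq_modelDeriv]
  have : (fun h : H => 1 * h * 1⁻¹) = id := by ext; simp
  rw [this]
  exact modelDeriv_id _

theorem Ad_mul (g h : H) : Ad (n := d) (g * h) = (Ad g).comp (Ad h) := by
  have : (fun x : H => (g * h) * x * (g * h)⁻¹) =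
      (fun x : H => g * x * g⁻¹) ∘ (fun x : H => h * x * h⁻¹) := by
    ext x; simp [mul_assoc]
  rw [Ad_eq_modelDeriv, this]
  exact modelDeriv_comp ((contMDiff_conj g).mdifferentiableAt (by simp))
    ((contMDiff_conj h).mdifferentiableAt (by simp)) (by simp)

theorem Ad_mul_apply (g h : H) (X : GroupLieAlgebra (𝓡 d) H) :
    Ad (g * h) X = Ad g (Ad h X) := by rw [Ad_mul]; rfl

@[simp] theorem Ad_inv_Ad (g : H) (X : GroupLieAlgebra (𝓡 d) H) : Ad g⁻¹ (Ad g X) = X := by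
  rw [← Ad_mul_apply, inv_mul_cancel, Ad_one]; rfl

@[simp] theorem Ad_Ad_inv (g : H) (X : GroupLieAlgebra (𝓡 d) H) : Ad g (Ad g⁻¹ X) = X := by
  rw [← Ad_mul_apply, mul_inv_cancel, Ad_one]; rfl

/-- Right translation by `g` maps `Ad g X` to the left translate of `X`. -/
theorem modelDeriv_mul_right_Ad (g : H) (X : GroupLieAlgebra (𝓡 d) H) :
    modelDeriv d d (· * g) (1 : H) (Ad g X) = modelDeriv d d (g * ·) (1 : H) X := by
  have h : (fun x : H => g * x) = (· * g) ∘ (fun x : H => g * x * g⁻¹) := by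
    ext x; simp
  rw [h, modelDeriv_comp (mdifferentiableAt_mul_right g 1)
    ((contMDiff_conj g).mdifferentiableAt (by simp)) (by simp)]
  rfl

/-- The multiplication in the preferred chart around the identity. -/
def chartMul (H : Type*) [TopologicalSpace H] [ChartedSpace (EuclideanSpace ℝ (Fin d)) H]
    [Group H] (p : Eu d × Eu d) : Eu d :=
  extChartAt (𝓡 d) (1 : H)
    ((extChartAt (𝓡 d) (1 : H)).symm p.1 * (extChartAt (𝓡 d) (1 : H)).symm p.2)

local notation "φ₁" => extChartAt (𝓡 d) (1 : H)

theorem contMDiffAt_chart {g : H} (hg : g ∈ (φ₁).source) :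
    ContMDiffAt (𝓡 d) (𝓡 d) ∞ φ₁ g := by
  have : IsManifold (𝓡 d) ∞ H := inferInstance
  exact contMDiffAt_extChartAt' (by simpa using hg)

theorem contMDiffAt_chart_symm {a : Eu d} (ha : a ∈ (φ₁).target) :
    ContMDiffAt (𝓡 d) (𝓡 d) ∞ (φ₁).symm a :=
  (contMDiffOn_extChartAt_symm (n := ∞) (I := 𝓡 d) (1 : H)).contMDiffAt
    ((isOpen_extChartAt_target (I := 𝓡 d) (1 : H)).mem_nhds ha)

theorem contDiffAt_chartMul_of_mem {a b : Eu d} (ha : a ∈ (φ₁).target) (hb : b ∈ (φ₁).target)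
    (hab : (φ₁).symm a * (φ₁).symm b ∈ (φ₁).source) :
    ContDiffAt ℝ ∞ (chartMul (d := d) H) (a, b) := by
  rw [← contMDiffAt_iff_contDiffAt]
  have h1 : ContMDiffAt 𝓘(ℝ, Eu d × Eu d) (𝓡 d) ∞
      (fun p : Eu d × Eu d => (φ₁).symm p.1) (a, b) :=
    ContMDiffAt.comp (a, b) (g := (φ₁).symm) (f := Prod.fst) (contMDiffAt_chart_symm ha)
      contDiffAt_fst.contMDiffAt
  have h2 : ContMDiffAt 𝓘(ℝ, Eu d × Eu d) (𝓡 d) ∞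
      (fun p : Eu d × Eu d => (φ₁).symm p.2) (a, b) :=
    ContMDiffAt.comp (a, b) (g := (φ₁).symm) (f := Prod.snd) (contMDiffAt_chart_symm hb)
      contDiffAt_snd.contMDiffAt
  exact ContMDiffAt.comp (a, b) (contMDiffAt_chart hab) (h1.mul h2)

omit [LieGroup (𝓡 d) ∞ H] in
theorem one_mem_chart_source : (1 : H) ∈ (φ₁).source := mem_extChartAt_source (1 : H)

theorem contDiffAt_chartMul : ContDiffAt ℝ ∞ (chartMul (d := d) H) (φ₁ 1, φ₁ 1) := by
  apply contDiffAt_chartMul_of_mem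
  · exact mem_extChartAt_target (1 : H)
  · exact mem_extChartAt_target (1 : H)
  · simp

theorem modelDeriv_chart_symm_one :
    modelDeriv d d (φ₁).symm (φ₁ 1) = ContinuousLinearMap.id ℝ (Eu d) := by
  have h := mfderivWithin_range_extChartAt_symm (I := 𝓡 d) (x := (1 : H))
  simp only [modelWithCornersSelf_coe, range_id, mfderivWithin_univ] at h
  exact h

theorem modelDeriv_chart_one : modelDeriv d d φ₁ (1 : H) = ContinuousLinearMap.id ℝ (Eu d) :=
  mfderiv_extChartAt_self (I := 𝓡 d) (x := (1 : H))

/-- This identifies left invariant vector fields, read in the chart, with partial derivatives of the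
multiplication. -/
theorem fderiv_chartMul_left {g : H} (hg : g ∈ (φ₁).source) (w : Eu d) :
    fderiv ℝ (chartMul (d := d) H) (φ₁ g, φ₁ 1) (0, w) =
      modelDeriv d d φ₁ g (modelDeriv d d (g * ·) (1 : H) w) := by
  have hs : (φ₁).symm (φ₁ g) = g := (φ₁).left_inv hg
  have hs1 : (φ₁).symm (φ₁ 1) = 1 := (φ₁).left_inv one_mem_chart_source
  have hdiff : DifferentiableAt ℝ (chartMul (d := d) H) (φ₁ g, φ₁ 1) := by
    refine (contDiffAt_chartMul_of_mem ((φ₁).map_source hg)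
      (mem_extChartAt_target (1 : H)) ?_).differentiableAt (by simp)
    rw [hs, hs1, mul_one]; exact hg
  have h1 : HasFDerivAt (fun b => chartMul (d := d) H (φ₁ g, b))
      ((fderiv ℝ (chartMul (d := d) H) (φ₁ g, φ₁ 1)).comp
        (ContinuousLinearMap.inr ℝ (Eu d) (Eu d))) (φ₁ 1) :=
    HasFDerivAt.comp (φ₁ 1) hdiff.hasFDerivAt
      ((hasFDerivAt_const (φ₁ g) (φ₁ 1)).prodMk (hasFDerivAt_id (φ₁ 1)))
  have h2 : (fun b => chartMul (d := d) H (φ₁ g, b)) = φ₁ ∘ (fun h => g * h) ∘ (φ₁).symm := by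
    ext1 b; simp only [chartMul, hs, comp_apply]
  have hsd : MDifferentiableAt (𝓡 d) (𝓡 d) (φ₁).symm (φ₁ 1) :=
    (contMDiffAt_chart_symm (mem_extChartAt_target (1 : H))).mdifferentiableAt (by simp)
  have h3 : modelDeriv d d (φ₁ ∘ (fun h => g * h) ∘ (φ₁).symm) (φ₁ 1) =
      (modelDeriv d d φ₁ g).comp (modelDeriv d d (g * ·) (1 : H)) := by
    rw [modelDeriv_comp (y := g) ((contMDiffAt_chart hg).mdifferentiableAt (by simp)) _
      (by simp), modelDeriv_comp (mdifferentiableAt_mul_left g 1) hsd hs1,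
      modelDeriv_chart_symm_one]
    · rfl
    · exact MDifferentiableAt.comp (φ₁ 1) (mdifferentiableAt_mul_left g _) hsd
  have h4 : modelDeriv d d (φ₁ ∘ (fun h => g * h) ∘ (φ₁).symm) (φ₁ 1) =
      fderiv ℝ (fun b => chartMul (d := d) H (φ₁ g, b)) (φ₁ 1) := by
    rw [h2]; exact mfderiv_eq_fderiv
  rw [h1.fderiv] at h4
  have h5 := congrArg (fun T => T w) (h4.symm.trans h3)
  simpa using h5

theorem fderiv_chartMul_right {g : H} (hg : g ∈ (φ₁).source) (w : Eu d) :
    fderiv ℝ (chartMul (d := d) H) (φ₁ 1, φ₁ g) (w, 0) =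
      modelDeriv d d φ₁ g (modelDeriv d d (· * g) (1 : H) w) := by
  have hs : (φ₁).symm (φ₁ g) = g := (φ₁).left_inv hg
  have hs1 : (φ₁).symm (φ₁ 1) = 1 := (φ₁).left_inv one_mem_chart_source
  have hdiff : DifferentiableAt ℝ (chartMul (d := d) H) (φ₁ 1, φ₁ g) := by
    refine (contDiffAt_chartMul_of_mem (mem_extChartAt_target (1 : H))
      ((φ₁).map_source hg) ?_).differentiableAt (by simp)
    rw [hs, hs1, one_mul]; exact hg
  have h1 : HasFDerivAt (fun b => chartMul (d := d) H (b, φ₁ g))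
      ((fderiv ℝ (chartMul (d := d) H) (φ₁ 1, φ₁ g)).comp
        (ContinuousLinearMap.inl ℝ (Eu d) (Eu d))) (φ₁ 1) :=
    HasFDerivAt.comp (f := fun b : Eu d => (b, φ₁ g)) (φ₁ 1) hdiff.hasFDerivAt
      ((hasFDerivAt_id (φ₁ 1)).prodMk (hasFDerivAt_const (φ₁ g) (φ₁ 1)))
  have h2 : (fun b => chartMul (d := d) H (b, φ₁ g)) = φ₁ ∘ (fun h => h * g) ∘ (φ₁).symm := by
    ext1 b; simp only [chartMul, hs, comp_apply]
  have hsd : MDifferentiableAt (𝓡 d) (𝓡 d) (φ₁).symm (φ₁ 1) :=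
    (contMDiffAt_chart_symm (mem_extChartAt_target (1 : H))).mdifferentiableAt (by simp)
  have h3 : modelDeriv d d (φ₁ ∘ (fun h => h * g) ∘ (φ₁).symm) (φ₁ 1) =
      (modelDeriv d d φ₁ g).comp (modelDeriv d d (· * g) (1 : H)) := by
    rw [modelDeriv_comp (y := g) ((contMDiffAt_chart hg).mdifferentiableAt (by simp)) _
      (by simp), modelDeriv_comp (mdifferentiableAt_mul_right g 1) hsd hs1,
      modelDeriv_chart_symm_one]
    · rfl
    · exact MDifferentiableAt.comp (φ₁ 1) (mdifferentiableAt_mul_right g _) hsd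
  have h4 : modelDeriv d d (φ₁ ∘ (fun h => h * g) ∘ (φ₁).symm) (φ₁ 1) =
      fderiv ℝ (fun b => chartMul (d := d) H (b, φ₁ g)) (φ₁ 1) := by
    rw [h2]; exact mfderiv_eq_fderiv
  rw [h1.fderiv] at h4
  have h5 := congrArg (fun T => T w) (h4.symm.trans h3)
  simpa using h5

/-- The adjoint action on the model space. -/
def AdModel (g : H) : Eu d →L[ℝ] Eu d := Ad g

/-- The adjoint representation is smooth. -/
theorem contMDiff_Ad : ContMDiff (𝓡 d) 𝓘(ℝ, Eu d →L[ℝ] Eu d) ∞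
    (AdModel (d := d) (H := H)) := by
  intro g₀
  have hF : ContMDiffAt ((𝓡 d).prod (𝓡 d)) (𝓡 d) ∞
      (uncurry (fun g h : H => g * h * g⁻¹)) (g₀, 1) :=
    ((contMDiff_fst.mul contMDiff_snd).mul contMDiff_fst.inv).contMDiffAt
  have := ContMDiffAt.mfderiv (m := ∞) (n := ∞) (x₀ := g₀) (fun g h : H => g * h * g⁻¹)
    (fun _ => (1 : H)) hF contMDiffAt_const (by simp)
  refine this.congr_of_eventuallyEq (Eventually.of_forall fun g => ?_)
  -- The base point `g * 1 * g⁻¹` is the identity for every `g`, so the tangent coordinate changes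
  -- are derivatives of one chart at its centre, which are the identity.
  rw [inTangentCoordinates_eq_mfderiv_comp (by simp) (by simp)]
  have h1 : ∀ x y : H, x = 1 → y = 1 →
      modelDeriv d d (extChartAt (𝓡 d) x) y = ContinuousLinearMap.id ℝ (Eu d) := by
    rintro x y rfl rfl; exact modelDeriv_chart_one
  have h2 := h1 (g₀ * 1 * g₀⁻¹) (g * 1 * g⁻¹) (by simp) (by simp)
  have h3 : modelDeriv d d (φ₁).symm (φ₁ 1) = mfderivWithin (𝓡 d) (𝓡 d) (φ₁).symm (range (𝓡 d))
      (φ₁ 1) := by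
    simp only [modelWithCornersSelf_coe, range_id, mfderivWithin_univ]; rfl
  rw [modelDeriv_chart_symm_one] at h3
  ext1 X
  have e1 := congrArg (fun T => T X) h3
  have e2 := congrArg (fun T => T (Ad g X)) h2
  exact (e2.symm.trans (congrArg (fun Y => modelDeriv d d (extChartAt (𝓡 d) (g₀ * 1 * g₀⁻¹))
    (g * 1 * g⁻¹) (Ad g Y)) e1))

theorem contMDiff_Ad_apply (X : GroupLieAlgebra (𝓡 d) H) :
    ContMDiff (𝓡 d) (𝓡 d) ∞ (fun g : H => toModel (Ad g X)) :=
  (ContinuousLinearMap.apply ℝ (Eu d) (toModel X)).contMDiff.comp contMDiff_Ad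

end GroupChart

end WeylSym

namespace WeylSym

open Filter Topology VectorField

section Velocity

variable {a b : ℕ} {M₁ M₂ : Type*} [TopologicalSpace M₁] [ChartedSpace (Eu a) M₁]
  [TopologicalSpace M₂] [ChartedSpace (Eu b) M₂]

/-- The curve `γ` has velocity `v` at time `t`. -/
def HasVelocity (γ : ℝ → M₁) (t : ℝ) (v : Eu a) : Prop :=
  HasMFDerivAt 𝓘(ℝ, ℝ) (𝓡 a) γ t ((1 : ℝ →L[ℝ] ℝ).smulRight v : ℝ →L[ℝ] Eu a)

theorem HasVelocity.comp {γ : ℝ → M₁} {t : ℝ} {v : Eu a} (h : HasVelocity γ t v) {f : M₁ → M₂}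
    (hf : MDifferentiableAt (𝓡 a) (𝓡 b) f (γ t)) :
    HasVelocity (fun s => f (γ s)) t (modelDeriv a b f (γ t) v) := by
  have h1 : HasMFDerivAt 𝓘(ℝ, ℝ) (𝓡 b) (f ∘ γ) t
    ((modelDeriv a b f (γ t)).comp ((1 : ℝ →L[ℝ] ℝ).smulRight v : ℝ →L[ℝ] Eu a)) :=
    HasMFDerivAt.comp t hf.hasMFDerivAt h
  have h2 : (modelDeriv a b f (γ t)).comp ((1 : ℝ →L[ℝ] ℝ).smulRight v : ℝ →L[ℝ] Eu a) =
      (1 : ℝ →L[ℝ] ℝ).smulRight (modelDeriv a b f (γ t) v) := by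
    ext1; simp
  exact (congrArg (fun T : ℝ →L[ℝ] Eu b => HasMFDerivAt 𝓘(ℝ, ℝ) (𝓡 b) (f ∘ γ) t T) h2).mp h1

theorem hasVelocity_iff_hasDerivAt {f : ℝ → Eu a} {t : ℝ} {v : Eu a} :
    HasVelocity f t v ↔ HasDerivAt f v t := by
  rw [HasVelocity, hasDerivAt_iff_hasFDerivAt]
  exact hasMFDerivAt_iff_hasFDerivAt

end Velocity

/-! ### The bracket as the derivative of the adjoint action -/

section Bracket

variable {d : ℕ} {H : Type*} [TopologicalSpace H] [ChartedSpace (EuclideanSpace ℝ (Fin d)) H]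
  [Group H] [LieGroup (𝓡 d) ∞ H]

local notation "φ₁" => extChartAt (𝓡 d) (1 : H)

/-- In the chart at `1` the bracket is that of partial derivatives of `chartMul`, so the local group
computation applies with `A a = Ad a Y`. Its hypothesis is that right translation by `g` sends `Ad g
Y` to the left translate of `Y`. -/
theorem lie_eq_modelDeriv_Ad (X Y : GroupLieAlgebra (𝓡 d) H) :
    ⁅X, Y⁆ = modelDeriv d d (fun g : H => toModel (Ad g Y)) (1 : H) X := by
  have hs1 : (φ₁).symm (φ₁ 1) = 1 := (φ₁).left_inv one_mem_chart_source
  have hmem : (φ₁).target ∈ 𝓝 (φ₁ (1 : H)) := extChartAt_target_mem_nhds (1 : H)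
  -- the left invariant vector fields in the chart
  have hfield : ∀ Z : GroupLieAlgebra (𝓡 d) H,
      (mpullbackWithin 𝓘(ℝ, Eu d) (𝓡 d) (φ₁).symm (mulInvariantVectorField (I := 𝓡 d) Z)
        (range (𝓡 d))) =ᶠ[𝓝 (φ₁ (1 : H))]
      (fun a => fderiv ℝ (chartMul (d := d) H) (a, φ₁ 1) (0, toModel Z) : Eu d → Eu d) := by
    intro Z
    filter_upwards [hmem] with a ha
    have hinv : (mfderivWithin 𝓘(ℝ, Eu d) (𝓡 d) (φ₁).symm (range (𝓡 d)) a).inverse =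
        mfderiv (𝓡 d) 𝓘(ℝ, Eu d) φ₁ ((φ₁).symm a) :=
      ContinuousLinearMap.inverse_eq
        (mfderivWithin_extChartAt_symm_comp_mfderiv_extChartAt ha)
        (mfderiv_extChartAt_comp_mfderivWithin_extChartAt_symm ha)
    rw [mpullbackWithin_apply, hinv]
    have := fderiv_chartMul_left (H := H) ((φ₁).map_target ha) (toModel Z)
    rw [(φ₁).right_inv ha] at this
    exact this.symm
  have h1 : ⁅X, Y⁆ = lieBracket ℝ
      (fun a => fderiv ℝ (chartMul (d := d) H) (a, φ₁ 1) (0, toModel X))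
      (fun a => fderiv ℝ (chartMul (d := d) H) (a, φ₁ 1) (0, toModel Y)) (φ₁ (1 : H)) := by
    have h0 : ⁅X, Y⁆ = (modelDeriv d d φ₁ (1 : H)).inverse (lieBracketWithin ℝ
        (mpullbackWithin 𝓘(ℝ, Eu d) (𝓡 d) (φ₁).symm (mulInvariantVectorField (I := 𝓡 d) X)
          (range (𝓡 d)) : Eu d → Eu d)
        (mpullbackWithin 𝓘(ℝ, Eu d) (𝓡 d) (φ₁).symm (mulInvariantVectorField (I := 𝓡 d) Y)
          (range (𝓡 d)) : Eu d → Eu d)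
        ((φ₁).symm ⁻¹' univ ∩ range (𝓡 d)) (φ₁ 1)) := rfl
    have h0' : ∀ V W : Eu d → Eu d, lieBracketWithin ℝ V W
        ((φ₁).symm ⁻¹' univ ∩ range (𝓡 d)) (φ₁ (1 : H)) = lieBracket ℝ V W (φ₁ 1) := by
      intro V W
      simp only [preimage_univ, univ_inter, modelWithCornersSelf_coe, range_id]
      rw [lieBracketWithin_univ]
    rw [h0, modelDeriv_chart_one, ContinuousLinearMap.inverse_id, ContinuousLinearMap.id_apply]
    exact (h0' _ _).trans ((hfield X).lieBracket_vectorField_eq (hfield Y))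
  -- the adjoint action in the chart
  have hAd : ContMDiffAt (𝓡 d) (𝓡 d) ∞ (fun a => toModel (Ad ((φ₁).symm a) Y)) (φ₁ (1 : H)) :=
    ContMDiffAt.comp (φ₁ (1 : H)) (g := fun g : H => toModel (Ad g Y))
      (contMDiff_Ad_apply Y).contMDiffAt (contMDiffAt_chart_symm (mem_extChartAt_target (1 : H)))
  have h2 := lieBracket_eq_fderiv_of_local_group (μ := chartMul (d := d) H) (e := φ₁ 1)
    (contDiffAt_chartMul.of_le (WithTop.coe_le_coe.2 (le_top : (2 : ℕ∞) ≤ ⊤)))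
    (A := fun a => toModel (Ad ((φ₁).symm a) Y))
    (hAd.contDiffAt.differentiableAt (by simp)) (X := toModel X) (Y := toModel Y)
    (by rw [hs1, Ad_one]; rfl)
    (fun Z => by
      have : (fun x : H => x * 1) = id := by ext; simp
      rw [fderiv_chartMul_right one_mem_chart_source, this, modelDeriv_id, modelDeriv_chart_one]
      rfl)
    (fun Z => by
      have : (fun x : H => 1 * x) = id := by ext; simp
      rw [fderiv_chartMul_left one_mem_chart_source, this, modelDeriv_id, modelDeriv_chart_one]
      rfl)
    (by
      filter_upwards [hmem] with a ha
      have e1 := fderiv_chartMul_right (H := H) ((φ₁).map_target ha)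
        (toModel (Ad ((φ₁).symm a) Y))
      have e2 := fderiv_chartMul_left (H := H) ((φ₁).map_target ha) (toModel Y)
      rw [(φ₁).right_inv ha] at e1 e2
      rw [e1, e2]
      exact congrArg _ (modelDeriv_mul_right_Ad ((φ₁).symm a) Y))
  rw [h1, h2]
  have h3 : fderiv ℝ (fun a => toModel (Ad ((φ₁).symm a) Y)) (φ₁ 1) =
      modelDeriv d d ((fun g : H => toModel (Ad g Y)) ∘ (φ₁).symm) (φ₁ 1) :=
    (mfderiv_eq_fderiv).symm
  rw [h3, modelDeriv_comp (y := 1) ((contMDiff_Ad_apply Y).mdifferentiableAt (by simp))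
    ((contMDiffAt_chart_symm (mem_extChartAt_target (1 : H))).mdifferentiableAt (by simp)) hs1,
    modelDeriv_chart_symm_one]
  rfl

theorem mdifferentiableAt_Ad_apply (Y : GroupLieAlgebra (𝓡 d) H) (g : H) :
    MDifferentiableAt (𝓡 d) (𝓡 d) (fun g : H => toModel (Ad g Y)) g :=
  (contMDiff_Ad_apply Y).mdifferentiableAt (by simp)

theorem modelDeriv_clm {a b : ℕ} (T : Eu a →L[ℝ] Eu b) (x : Eu a) : modelDeriv a b T x = T :=
  mfderiv_eq_fderiv.trans T.fderiv

/-- Differentiate `Ad (g h g⁻¹) (Ad g Y) = Ad g (Ad h Y)` with respect to `h` at the identity. -/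
theorem Ad_lie (g : H) (X Y : GroupLieAlgebra (𝓡 d) H) : Ad g ⁅X, Y⁆ = ⁅Ad g X, Ad g Y⁆ := by
  rw [lie_eq_modelDeriv_Ad, lie_eq_modelDeriv_Ad]
  have h1 : (fun h : H => toModel (Ad h (Ad g Y))) ∘ (fun h : H => g * h * g⁻¹) =
      AdModel g ∘ (fun h : H => toModel (Ad h Y)) := by
    ext1 h
    simp only [comp_apply, Ad_mul_apply, Ad_inv_Ad]
    rfl
  have h2 := modelDeriv_comp (mdifferentiableAt_Ad_apply (Ad g Y) 1)
    ((contMDiff_conj g).mdifferentiableAt (by simp)) (show g * 1 * g⁻¹ = 1 by simp)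
  rw [h1, modelDeriv_comp (y := toModel (Ad 1 Y))
    (ContinuousLinearMap.mdifferentiableAt _) (mdifferentiableAt_Ad_apply Y 1) rfl,
    modelDeriv_clm] at h2
  exact congrArg (fun T => T (toModel X)) h2

/-- `Ad g` as an automorphism of the Lie algebra. -/
def AdEquiv (g : H) : GroupLieAlgebra (𝓡 d) H ≃ₗ⁅ℝ⁆ GroupLieAlgebra (𝓡 d) H where
  toFun := Ad g
  map_add' := map_add _
  map_smul' := map_smul _
  map_lie' := Ad_lie g _ _
  invFun := Ad g⁻¹
  left_inv := Ad_inv_Ad g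
  right_inv := Ad_Ad_inv g

end Bracket

end WeylSym

namespace WeylSym

open Filter Topology VectorField

/-! ### One-parameter subgroups and the exponential map -/

section Exponential

variable {d : ℕ} {H : Type*} [TopologicalSpace H] [ChartedSpace (EuclideanSpace ℝ (Fin d)) H]
  [Group H] [LieGroup (𝓡 d) ∞ H]

local notation "φ₁" => extChartAt (𝓡 d) (1 : H)

/-- A vector of the model space as an element of the Lie algebra. -/
def ofModel (H : Type*) [TopologicalSpace H] [ChartedSpace (EuclideanSpace ℝ (Fin d)) H]
    [Group H] (v : Eu d) : GroupLieAlgebra (𝓡 d) H := v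

omit [LieGroup (𝓡 d) ∞ H] in
theorem toModel_add (X Y : GroupLieAlgebra (𝓡 d) H) : toModel (X + Y) = toModel X + toModel Y := rfl

theorem modelDeriv_mul_left_comp (g h : H) (X : Eu d) :
    modelDeriv d d (g * ·) h (modelDeriv d d (h * ·) (1 : H) X) =
      modelDeriv d d (g * h * ·) (1 : H) X := by
  have : (fun x : H => g * h * x) = (g * ·) ∘ (h * ·) := by ext x; simp [mul_assoc]
  rw [this, modelDeriv_comp (mdifferentiableAt_mul_left g h) (mdifferentiableAt_mul_left h 1)
    (mul_one h)]
  rfl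

theorem modelDeriv_mul_right_mul_left (g h : H) (X : GroupLieAlgebra (𝓡 d) H) :
    modelDeriv d d (· * h) g (modelDeriv d d (g * ·) (1 : H) (toModel X)) =
      modelDeriv d d (g * h * ·) (1 : H) (toModel (Ad h⁻¹ X)) := by
  have h1 : (fun x : H => x * h) ∘ (fun x => g * x) =
      (fun x => g * h * x) ∘ (fun x => h⁻¹ * x * h⁻¹⁻¹) := by
    ext x; simp [mul_assoc]
  have h2 := modelDeriv_comp (mdifferentiableAt_mul_right (d := d) h g)
    (mdifferentiableAt_mul_left (d := d) g 1) (mul_one g)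
  rw [h1, modelDeriv_comp (y := 1) (mdifferentiableAt_mul_left (g * h) 1)
    ((contMDiff_conj h⁻¹).mdifferentiableAt (by simp)) (by simp)] at h2
  exact (congrArg (fun T => T (toModel X)) h2).symm

theorem HasVelocity.mul {α β : ℝ → H} {t : ℝ} {v w : Eu d} (hα : HasVelocity α t v)
    (hβ : HasVelocity β t w) :
    HasVelocity (fun s => α s * β s) t
      (modelDeriv d d (· * β t) (α t) v + modelDeriv d d (α t * ·) (β t) w) := by
  have hm : MDifferentiableAt ((𝓡 d).prod (𝓡 d)) (𝓡 d) (fun p : H × H => p.1 * p.2) (α t, β t) :=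
    (contMDiff_mul (𝓡 d) ∞).mdifferentiableAt (by simp)
  have h1 := HasMFDerivAt.comp (f := fun s => (α s, β s)) t hm.hasMFDerivAt
    (HasMFDerivAt.prodMk hα hβ)
  have h2 : ∀ T : ℝ →L[ℝ] Eu d, T = ((1 : ℝ →L[ℝ] ℝ).smulRight (T 1) : ℝ →L[ℝ] Eu d) := by
    intro T; ext1; simp
  have h3 := (congrArg (fun T : ℝ →L[ℝ] Eu d => HasMFDerivAt 𝓘(ℝ, ℝ) (𝓡 d)
    ((fun p : H × H => p.1 * p.2) ∘ fun s => (α s, β s)) t T) (h2 _)).mp h1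
  have h4 := mfderiv_prod_eq_add_apply (v := ((v, w) : Eu d × Eu d)) hm
  have h5 : mfderiv ((𝓡 d).prod (𝓡 d)) (𝓡 d) (fun p : H × H => p.1 * p.2) (α t, β t)
      (((1 : ℝ →L[ℝ] ℝ) 1 • v, (1 : ℝ →L[ℝ] ℝ) 1 • w) : Eu d × Eu d) =
      modelDeriv d d (· * β t) (α t) v + modelDeriv d d (α t * ·) (β t) w := by
    have h6 : (((1 : ℝ →L[ℝ] ℝ) 1 • v, (1 : ℝ →L[ℝ] ℝ) 1 • w) : Eu d × Eu d) = (v, w) := by simp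
    rw [h6]
    exact h4
  exact (congrArg (fun u : Eu d => HasVelocity (fun s => α s * β s) t u) h5).mp h3

omit [LieGroup (𝓡 d) ∞ H] in
theorem isMIntegralCurve_iff_hasVelocity {X : GroupLieAlgebra (𝓡 d) H} {γ : ℝ → H} :
    IsMIntegralCurve (I := 𝓡 d) γ (fun g : H => mulInvariantVectorField (I := 𝓡 d) X g) ↔
      ∀ t, HasVelocity γ t (modelDeriv d d (γ t * ·) (1 : H) (toModel X)) := Iff.rfl

theorem contMDiff_one_mulInvariantVectorField (X : GroupLieAlgebra (𝓡 d) H) :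
    ContMDiff (𝓡 d) (𝓡 d).tangent 1
      (fun g : H => (⟨g, mulInvariantVectorField (I := 𝓡 d) X g⟩ : TangentBundle (𝓡 d) H)) :=
  (contMDiff_mulInvariantVectorField (I := 𝓡 d) X).of_le (by
    rw [minSmoothness_of_isRCLikeNormedField]; norm_num)

/-- Left translates of one local integral curve are integral curves, so all points share the same
existence time `ε` and solutions extend to all of `ℝ`. -/
theorem exists_oneParameterSubgroup [T2Space H] (X : GroupLieAlgebra (𝓡 d) H) :
    ∃ γ : ℝ → H, γ 0 = 1 ∧
      IsMIntegralCurve (I := 𝓡 d) γ (fun g : H => mulInvariantVectorField (I := 𝓡 d) X g) := by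
  obtain ⟨γ, hγ0, hγ⟩ := exists_isMIntegralCurveAt_of_contMDiffAt_boundaryless (I := 𝓡 d) 0
    (contMDiff_one_mulInvariantVectorField X (1 : H))
  rw [isMIntegralCurveAt_iff'] at hγ
  obtain ⟨ε, hε, hγ⟩ := hγ
  rw [Real.ball_eq_Ioo, zero_sub, zero_add] at hγ
  have hγ' : ∀ t ∈ Ioo (-ε) ε, HasVelocity γ t (modelDeriv d d (γ t * ·) (1 : H) (toModel X)) :=
    fun t ht => (hγ t ht).hasMFDerivAt (isOpen_Ioo.mem_nhds ht)
  refine exists_isMIntegralCurve_of_isMIntegralCurveOn (contMDiff_one_mulInvariantVectorField X)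
    hε (fun g => ⟨fun t => g * γ t, by simp [hγ0], fun t ht => ?_⟩) 1
  have := (hγ' t ht).comp (mdifferentiableAt_mul_left g (γ t))
  rw [modelDeriv_mul_left_comp] at this
  exact HasMFDerivAt.hasMFDerivWithinAt this

theorem lieExp_eq [T2Space H] {X : GroupLieAlgebra (𝓡 d) H} {γ : ℝ → H} (h0 : γ 0 = 1)
    (hγ : ∀ t, HasVelocity γ t (modelDeriv d d (γ t * ·) (1 : H) (toModel X))) : lieExp X = γ 1 := by
  have h : ∃ γ : ℝ → H, γ 0 = 1 ∧
      IsMIntegralCurve (I := 𝓡 d) γ (fun g : H => mulInvariantVectorField (I := 𝓡 d) X g) :=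
    ⟨γ, h0, hγ⟩
  rw [lieExp, dif_pos h]
  exact congrFun (isMIntegralCurve_Ioo_eq_of_contMDiff_boundaryless (t₀ := 0)
    (contMDiff_one_mulInvariantVectorField X) h.choose_spec.2 hγ (h.choose_spec.1.trans h0.symm)) 1

theorem lieExp_smul_eq [T2Space H] {X : GroupLieAlgebra (𝓡 d) H} {γ : ℝ → H} (h0 : γ 0 = 1)
    (hγ : ∀ t, HasVelocity γ t (modelDeriv d d (γ t * ·) (1 : H) (toModel X))) (t : ℝ) :
    lieExp (t • X) = γ t := by
  have h1 : IsMIntegralCurve (I := 𝓡 d) (γ ∘ (· * t))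
      (t • (fun g : H => mulInvariantVectorField (I := 𝓡 d) X g)) :=
    IsMIntegralCurve.comp_mul (isMIntegralCurve_iff_hasVelocity.2 hγ) t
  have h2 : (t • (fun g : H => mulInvariantVectorField (I := 𝓡 d) X g)) =
      (fun g : H => mulInvariantVectorField (I := 𝓡 d) (t • X) g) := by
    rw [mulInvariantVectorField_smul]
  rw [h2] at h1
  have := lieExp_eq (X := t • X) (γ := γ ∘ (· * t)) (by simp [h0])
    (isMIntegralCurve_iff_hasVelocity.1 h1)
  simpa using this

theorem hasVelocity_lieExp [T2Space H] (X : GroupLieAlgebra (𝓡 d) H) (t : ℝ) :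
    HasVelocity (fun s : ℝ => lieExp (s • X)) t
      (modelDeriv d d (lieExp (t • X) * ·) (1 : H) (toModel X)) := by
  obtain ⟨γ, h0, hγ⟩ := exists_oneParameterSubgroup X
  have := funext fun s => lieExp_smul_eq h0 (isMIntegralCurve_iff_hasVelocity.1 hγ) s
  rw [this, lieExp_smul_eq h0 (isMIntegralCurve_iff_hasVelocity.1 hγ) t]
  exact isMIntegralCurve_iff_hasVelocity.1 hγ t

theorem lieExp_zero [T2Space H] : lieExp (0 : GroupLieAlgebra (𝓡 d) H) = 1 := by
  obtain ⟨γ, h0, hγ⟩ := exists_oneParameterSubgroup (0 : GroupLieAlgebra (𝓡 d) H)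
  have := lieExp_smul_eq h0 (isMIntegralCurve_iff_hasVelocity.1 hγ) 0
  rwa [smul_zero, h0] at this

/-- After translation of the value at `t₀` to the identity, the curve solves a smooth autonomous
equation in the chart. Smoothness along lines is all that is needed later, because `𝔤₁` is abelian.
-/
theorem contMDiff_lieExp_smul [T2Space H] (X : GroupLieAlgebra (𝓡 d) H) :
    ContMDiff 𝓘(ℝ, ℝ) (𝓡 d) ∞ (fun t : ℝ => lieExp (t • X)) := by
  intro t₀
  set γ : ℝ → H := fun t => lieExp (t • X) with hγ
  set g : ℝ → H := fun t => (γ t₀)⁻¹ * γ t with hg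
  have hg0 : g t₀ = 1 := inv_mul_cancel _
  have hgv : ∀ t, HasVelocity g t (modelDeriv d d (g t * ·) (1 : H) (toModel X)) := fun t => by
    have := (hasVelocity_lieExp X t).comp (mdifferentiableAt_mul_left (γ t₀)⁻¹ (γ t))
    rwa [modelDeriv_mul_left_comp] at this
  have hsrc : ∀ᶠ t in 𝓝 t₀, g t ∈ (φ₁).source := by
    have hc : ContinuousAt g t₀ := (hgv t₀).1
    apply hc.preimage_mem_nhds
    rw [hg0]; exact extChartAt_source_mem_nhds (1 : H)
  set W : Eu d → Eu d := fun a => fderiv ℝ (chartMul (d := d) H) (a, φ₁ 1) (0, toModel X) with hW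
  have hWs : ContDiffAt ℝ ∞ W (φ₁ (g t₀)) := by
    rw [hg0]
    have h1 : ContDiffAt ℝ ∞ (fderiv ℝ (chartMul (d := d) H)) (φ₁ 1, φ₁ 1) :=
      contDiffAt_chartMul.fderiv_right (by simp)
    exact (h1.comp (φ₁ (1 : H)) (f := fun a : Eu d => (a, φ₁ (1 : H)))
      (contDiffAt_id.prodMk contDiffAt_const)).clm_apply contDiffAt_const
  have hf : ContDiffAt ℝ ∞ (fun t => φ₁ (g t)) t₀ := by
    refine contDiffAt_of_hasDerivAt hWs ?_
    filter_upwards [hsrc] with t ht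
    have h1 := (hgv t).comp ((contMDiffAt_chart ht).mdifferentiableAt (by simp))
    rw [← fderiv_chartMul_left ht] at h1
    exact hasVelocity_iff_hasDerivAt.1 h1
  have h2 : ContMDiffAt 𝓘(ℝ, ℝ) (𝓡 d) ∞ (fun t => γ t₀ * (φ₁).symm (φ₁ (g t))) t₀ := by
    refine (contMDiffAt_const (c := γ t₀)).mul
      (ContMDiffAt.comp t₀ (g := (φ₁).symm) (contMDiffAt_chart_symm ?_) hf.contMDiffAt)
    rw [hg0]; exact mem_extChartAt_target (1 : H)
  refine h2.congr_of_eventuallyEq ?_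
  filter_upwards [hsrc] with t ht
  rw [(φ₁).left_inv ht]; simp [hg]

/-- Multiplicativity of `Ad` moves the derivative at `exp (t X)` back to the identity, where it is
the bracket. -/
theorem hasDerivAt_Ad_lieExp [T2Space H] (X Y : GroupLieAlgebra (𝓡 d) H) (t : ℝ) :
    HasDerivAt (fun s : ℝ => toModel (Ad (lieExp (s • X)) Y))
      (toModel (Ad (lieExp (t • X)) ⁅X, Y⁆)) t := by
  set g := lieExp (t • X) with hg
  have h1 := (hasVelocity_lieExp X t).comp (mdifferentiableAt_Ad_apply Y g)
  rw [← hasVelocity_iff_hasDerivAt]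
  have h2 : modelDeriv d d (fun h : H => toModel (Ad h Y)) g (modelDeriv d d (g * ·) (1 : H) (toModel X)) =
      toModel (Ad g ⁅X, Y⁆) := by
    have h3 := modelDeriv_comp (mdifferentiableAt_Ad_apply Y g) (mdifferentiableAt_mul_left g 1)
      (mul_one g)
    have h4 : (fun h : H => toModel (Ad h Y)) ∘ (g * ·) =
        AdModel g ∘ (fun h : H => toModel (Ad h Y)) := by
      ext1 h
      simp only [comp_apply, Ad_mul_apply]
      rfl
    rw [h4, modelDeriv_comp (y := toModel (Ad 1 Y))
      (ContinuousLinearMap.mdifferentiableAt _) (mdifferentiableAt_Ad_apply Y 1) rfl,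
      modelDeriv_clm] at h3
    rw [lie_eq_modelDeriv_Ad]
    exact (congrArg (fun T => T X) h3).symm
  rw [← h2]
  exact h1

/-- `Ad (exp X) Y = Y + [X, Y]` if `[X, [X, Y]] = 0`. -/
theorem Ad_lieExp_of_lie_lie_eq_zero [T2Space H] {X Y : GroupLieAlgebra (𝓡 d) H}
    (h : ⁅X, ⁅X, Y⁆⁆ = 0) : Ad (lieExp X) Y = Y + ⁅X, Y⁆ := by
  -- Applied to `Z = ⁅X, Y⁆`, this makes the derivative of `Ad (exp (s X)) Y` constant in `s`.
  have key : ∀ Z : GroupLieAlgebra (𝓡 d) H, ⁅X, Z⁆ = 0 → ∀ t : ℝ,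
      toModel (Ad (lieExp (t • X)) Z) = toModel Z := by
    intro Z hZ t
    have h1 : ∀ s, HasDerivAt (fun s : ℝ => toModel (Ad (lieExp (s • X)) Z)) 0 s := fun s => by
      have := hasDerivAt_Ad_lieExp X Z s
      rw [hZ, map_zero] at this
      exact this
    have h2 := is_const_of_deriv_eq_zero (fun s => (h1 s).differentiableAt)
      (fun s => (h1 s).deriv) t 0
    rw [h2, zero_smul, lieExp_zero, Ad_one]; rfl
  have h1 : ∀ s, HasDerivAt (fun s : ℝ => toModel (Ad (lieExp (s • X)) Y) - s • toModel ⁅X, Y⁆)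
      0 s := fun s => by
    have h2 := hasDerivAt_Ad_lieExp X Y s
    rw [key _ h s] at h2
    have h3 : HasDerivAt (fun s : ℝ => s • toModel ⁅X, Y⁆) ((1 : ℝ) • toModel ⁅X, Y⁆) s :=
      (hasDerivAt_id s).smul_const _
    have h4 := h2.sub h3
    rw [one_smul, sub_self] at h4
    exact h4
  have h2 := is_const_of_deriv_eq_zero (fun s => (h1 s).differentiableAt)
    (fun s => (h1 s).deriv) 1 0
  simp only [one_smul, zero_smul, lieExp_zero, Ad_one, sub_zero] at h2
  exact sub_eq_iff_eq_add.1 h2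

theorem Ad_lieExp_of_lie_eq_zero [T2Space H] {X Y : GroupLieAlgebra (𝓡 d) H}
    (h : ⁅X, Y⁆ = 0) : Ad (lieExp X) Y = Y := by
  rw [Ad_lieExp_of_lie_lie_eq_zero (by rw [h, lie_zero]), h, add_zero]

/-- `Ad (exp (t Y))` fixes `X`, so the product of the two one-parameter subgroups is an integral
curve for `X + Y`. -/
theorem lieExp_add [T2Space H] {X Y : GroupLieAlgebra (𝓡 d) H} (h : ⁅X, Y⁆ = 0) :
    lieExp (X + Y) = lieExp X * lieExp Y := by
  have h' : ⁅Y, X⁆ = 0 := by rw [← lie_skew, h, neg_zero]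
  rw [lieExp_eq (X := X + Y) (γ := fun t : ℝ => lieExp (t • X) * lieExp (t • Y))
    (by simp [lieExp_zero])]
  · simp
  intro t
  have h1 := (hasVelocity_lieExp X t).mul (hasVelocity_lieExp Y t)
  rw [modelDeriv_mul_left_comp, modelDeriv_mul_right_mul_left] at h1
  have h2 : Ad (lieExp (t • Y))⁻¹ X = X := by
    have : Ad (lieExp (t • Y)) X = X := Ad_lieExp_of_lie_eq_zero (by rw [smul_lie, h', smul_zero])
    conv_lhs => rw [← this]
    exact Ad_inv_Ad _ _
  rw [h2, ← map_add, ← toModel_add] at h1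
  exact h1

variable {d' : ℕ} {H' : Type*} [TopologicalSpace H']
  [ChartedSpace (EuclideanSpace ℝ (Fin d')) H'] [Group H'] [LieGroup (𝓡 d') ∞ H']

/-- Smooth homomorphisms intertwine the exponential maps. -/
theorem map_lieExp [T2Space H] [T2Space H'] (f : H →* H') (hf : ContMDiff (𝓡 d) (𝓡 d') ∞ f)
    (X : GroupLieAlgebra (𝓡 d) H) :
    f (lieExp X) = lieExp (ofModel H' (modelDeriv d d' f 1 (toModel X))) := by
  have hfd : ∀ g, MDifferentiableAt (𝓡 d) (𝓡 d') f g := fun g => hf.mdifferentiableAt (by simp)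
  rw [lieExp_eq (H := H') (γ := fun t : ℝ => f (lieExp (t • X))) (by simp [lieExp_zero])]
  · simp
  intro t
  have h1 := (hasVelocity_lieExp X t).comp (hfd (lieExp (t • X)))
  set g := lieExp (t • X)
  have h2 : f ∘ (g * ·) = (f g * ·) ∘ f := by ext; simp
  have h3 := modelDeriv_comp (hfd g) (mdifferentiableAt_mul_left g 1) (mul_one g)
  rw [h2, modelDeriv_comp (y := 1) (mdifferentiableAt_mul_left (f g) 1) (hfd 1) (map_one f)] at h3
  have h4 := congrArg (fun T => T (toModel X)) h3
  simp only [ContinuousLinearMap.comp_apply] at h4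
  rw [← h4] at h1
  exact h1

theorem conj_lieExp [T2Space H] (g : H) (X : GroupLieAlgebra (𝓡 d) H) :
    g * lieExp X * g⁻¹ = lieExp (Ad g X) :=
  map_lieExp (MulAut.conj g).toMonoidHom (contMDiff_conj g) X

end Exponential

end WeylSym

namespace WeylSym

open Filter Topology

theorem contMDiffOn_list_prod_map {E₁ H₁ N : Type*} [NormedAddCommGroup E₁] [NormedSpace ℝ E₁]
    [TopologicalSpace H₁] {J : ModelWithCorners ℝ E₁ H₁} [TopologicalSpace N] [ChartedSpace H₁ N]
    {d : ℕ} {H : Type*} [TopologicalSpace H] [ChartedSpace (EuclideanSpace ℝ (Fin d)) H]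
    [Group H] [LieGroup (𝓡 d) ∞ H] {ι : Type*} (l : List ι) (f : ι → N → H) {s : Set N}
    (hf : ∀ i, ContMDiffOn J (𝓡 d) ∞ (f i) s) :
    ContMDiffOn J (𝓡 d) ∞ (fun x => (l.map (fun i => f i x)).prod) s := by
  induction l with
  | nil => exact contMDiffOn_const
  | cons i l ih =>
    simp only [List.map_cons, List.prod_cons]
    exact (hf i).mul ih

/-! ### The structure of `P`: exponentials of `𝔤₁` and the stabilizer of `E` -/

section Parabolic

variable {n k : ℕ} {G : Type*} [TopologicalSpace G] [T2Space G]
  [ChartedSpace (EuclideanSpace ℝ (Fin n)) G] [Group G] [LieGroup (𝓡 n) ∞ G]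
  {𝔤 : OneGrading (n := n) G} {P : Subgroup G} [ChartedSpace (EuclideanSpace ℝ (Fin k)) P]

section Exp

omit [T2Space G] in
theorem IsParabolic.contMDiff_val (hP : IsParabolic (k := k) 𝔤 P) :
    ContMDiff (𝓡 k) (𝓡 n) ∞ (Subtype.val : P → G) :=
  hP.isSmoothEmbedding.contMDiff

variable [LieGroup (𝓡 k) ∞ P]

theorem IsParabolic.val_lieExp (hP : IsParabolic (k := k) 𝔤 P) (W : Eu k) :
    ((lieExp (ofModel P W) : P) : G) =
      lieExp (ofModel G (modelDeriv k n (Subtype.val : P → G) 1 W)) :=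
  map_lieExp P.subtype hP.contMDiff_val (ofModel P W)

omit [T2Space G] [LieGroup (𝓡 k) ∞ P] in
theorem IsParabolic.exists_of_mem_gr_one (hP : IsParabolic (k := k) 𝔤 P)
    {Z : GroupLieAlgebra (𝓡 n) G} (hZ : Z ∈ 𝔤.gr 1) :
    ∃ W : Eu k, ofModel G (modelDeriv k n (Subtype.val : P → G) 1 W) = Z := by
  have h1 : Z ∈ (𝔤.filt 0 : Set (GroupLieAlgebra (𝓡 n) G)) :=
    Submodule.mem_iSup_of_mem (⟨1, by norm_num⟩ : {j : ℤ // 0 ≤ j}) hZ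
  rw [← hP.lieAlgebra_eq] at h1
  exact h1

/-- The inclusion of `P` intertwines the exponential maps, and `𝔤₁` lies in the image of its
derivative. -/
theorem IsParabolic.lieExp_mem (hP : IsParabolic (k := k) 𝔤 P)
    {Z : GroupLieAlgebra (𝓡 n) G} (hZ : Z ∈ 𝔤.gr 1) : lieExp Z ∈ P := by
  obtain ⟨W, rfl⟩ := hP.exists_of_mem_gr_one hZ
  rw [← hP.val_lieExp]
  exact Subtype.property _

theorem IsParabolic.coe_expIn (hP : IsParabolic (k := k) 𝔤 P)
    {Z : GroupLieAlgebra (𝓡 n) G} (hZ : Z ∈ 𝔤.gr 1) : ((expIn P Z : P) : G) = lieExp Z := by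
  rw [expIn, dif_pos (hP.lieExp_mem hZ)]

/-- As `𝔤₁` is abelian, `exp` on it is a product of one-parameter subgroups along a basis. These are
taken in `P` itself, which gives smoothness for the manifold structure of `P`. -/
theorem contMDiffOn_expIn {E₁ H₁ N : Type*} [NormedAddCommGroup E₁] [NormedSpace ℝ E₁]
    [TopologicalSpace H₁] {J : ModelWithCorners ℝ E₁ H₁} [TopologicalSpace N] [ChartedSpace H₁ N]
    (hP : IsParabolic (k := k) 𝔤 P)
    (hab : ∀ X ∈ 𝔤.gr 1, ∀ Y ∈ 𝔤.gr 1, ⁅X, Y⁆ = 0) {s : Set N}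
    {Z : N → GroupLieAlgebra (𝓡 n) G} (hZ : ∀ x ∈ s, Z x ∈ 𝔤.gr 1)
    (hZs : ContMDiffOn J (𝓡 n) ∞ (fun x => toModel (Z x)) s) :
    ContMDiffOn J (𝓡 k) ∞ (fun x => expIn P (Z x)) s := by
  have : FiniteDimensional ℝ (GroupLieAlgebra (𝓡 n) G) := inferInstanceAs
    (FiniteDimensional ℝ (EuclideanSpace ℝ (Fin n)))
  let b := Module.finBasis ℝ (𝔤.gr 1)
  choose W hW using fun i => hP.exists_of_mem_gr_one (b i).2
  -- the coordinates in `𝔤₁`, extended to `𝔤`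
  obtain ⟨c, hc⟩ := LinearMap.exists_extend (b.equivFun.toLinearMap)
  let c' : Eu n →ₗ[ℝ] (Fin _ → ℝ) := c
  have hcs : ∀ i, ContMDiffOn J 𝓘(ℝ, ℝ) ∞ (fun x => c' (toModel (Z x)) i) s := by
    intro i
    let ci : Eu n →ₗ[ℝ] ℝ := (LinearMap.proj i).comp c'
    exact (ci.toContinuousLinearMap.contMDiff (n := ∞)).comp_contMDiffOn hZs
  have hsmooth := contMDiffOn_list_prod_map (J := J) (d := k) (H := P) (List.finRange _)
    (fun i x => lieExp ((c' (toModel (Z x)) i) • ofModel P (W i))) (s := s)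
    (fun i => (contMDiff_lieExp_smul (ofModel P (W i))).comp_contMDiffOn (hcs i))
  refine hsmooth.congr fun x hx => ?_
  have hlist : ∀ (t : Fin _ → ℝ) (l : List (Fin _)),
      (((l.map (fun i => lieExp (t i • ofModel P (W i)))).prod : P) : G) =
        lieExp (l.map (fun i => t i • ((b i : 𝔤.gr 1) : GroupLieAlgebra (𝓡 n) G))).sum ∧
      (l.map (fun i => t i • ((b i : 𝔤.gr 1) : GroupLieAlgebra (𝓡 n) G))).sum ∈ 𝔤.gr 1 := by
    intro t l
    induction l with
    | nil => simp [lieExp_zero]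
    | cons i l ih =>
      simp only [List.map_cons, List.prod_cons, List.sum_cons]
      have hi : t i • ((b i : 𝔤.gr 1) : GroupLieAlgebra (𝓡 n) G) ∈ 𝔤.gr 1 :=
        (𝔤.gr 1).smul_mem _ (b i).2
      refine ⟨?_, add_mem hi ih.2⟩
      rw [lieExp_add (hab _ hi _ ih.2), Subgroup.coe_mul, ih.1]
      have := hP.val_lieExp (t i • W i)
      rw [map_smul] at this
      rw [show t i • ofModel P (W i) = ofModel P (t i • W i) from rfl, this,
        show ofModel G (t i • modelDeriv k n (Subtype.val : P → G) 1 (W i)) =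
          t i • ofModel G (modelDeriv k n (Subtype.val : P → G) 1 (W i)) from rfl, hW]
  apply Subtype.ext
  rw [hP.coe_expIn (hZ x hx), (hlist _ _).1]
  congr 1
  have h1 : Z x = ∑ i, (b.repr ⟨Z x, hZ x hx⟩ i) • ((b i : 𝔤.gr 1) : GroupLieAlgebra (𝓡 n) G) := by
    have := congrArg (𝔤.gr 1).subtype (b.sum_repr ⟨Z x, hZ x hx⟩)
    rw [map_sum] at this
    exact this.symm
  have h2 : ∀ i, c' (toModel (Z x)) i = b.repr ⟨Z x, hZ x hx⟩ i := by
    intro i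
    have := congrFun (congrArg (fun f => f ⟨Z x, hZ x hx⟩) hc) i
    exact this
  rw [← Fin.sum_univ_def]
  refine h1.trans (Finset.sum_congr rfl fun i _ => ?_)
  rw [h2]

end Exp

section Structure

variable {E : GroupLieAlgebra (𝓡 n) G}

omit [T2Space G] in
theorem IsParabolic.Ad_mem_filt (hP : IsParabolic (k := k) 𝔤 P) (h : P) {i : ℤ}
    {X : GroupLieAlgebra (𝓡 n) G} (hX : X ∈ 𝔤.filt i) : Ad (h : G) X ∈ 𝔤.filt i :=
  hP.subset_maxP h.2 i X hX

omit [T2Space G] in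
theorem IsParabolic.Ad_mem_gr_one (hP : IsParabolic (k := k) 𝔤 P) (hE : GradingElement 𝔤.gr E)
    (h : P) {X : GroupLieAlgebra (𝓡 n) G} (hX : X ∈ 𝔤.gr 1) : Ad (h : G) X ∈ 𝔤.gr 1 := by
  have h1 : 𝔤.filt 1 = 𝔤.gr 1 := hE.pos_eq
  rw [← h1] at hX ⊢
  exact hP.Ad_mem_filt h hX

omit [T2Space G] in
theorem IsParabolic.Ad_sub_mem [LieAlgebra.IsSemisimple ℝ (GroupLieAlgebra (𝓡 n) G)]
    (hP : IsParabolic (k := k) 𝔤 P) (hE : GradingElement 𝔤.gr E) (h : P) :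
    Ad (h : G) E - E ∈ 𝔤.gr 1 :=
  hE.automorphism_sub_mem (AdEquiv (h : G)) (fun _ hX => hP.Ad_mem_filt h hX)
    (fun _ hX => hP.Ad_mem_filt h⁻¹ hX) (fun _ hX => hP.Ad_mem_gr_one hE h hX)
    (fun _ hX => hP.Ad_mem_gr_one hE h⁻¹ hX)

omit [T2Space G] in
-- If `h` preserves the grading, `Ad h E - E` lies in both `𝔤₀` and `𝔤₁`. Conversely, fixing `E`
-- preserves the eigenspaces of `ad E`.
theorem IsParabolic.mem_G0_iff [LieAlgebra.IsSemisimple ℝ (GroupLieAlgebra (𝓡 n) G)]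
    (hP : IsParabolic (k := k) 𝔤 P) (hE : GradingElement 𝔤.gr E) (h : P) :
    h ∈ 𝔤.G0 P ↔ Ad (h : G) E = E := by
  constructor
  · intro hh
    have h1 : Ad (h : G) E ∈ 𝔤.gr 0 := hh 0 E hE.mem_zero
    exact sub_eq_zero.1 (hE.disjoint_of_ne (by norm_num) (sub_mem h1 hE.mem_zero)
      (hP.Ad_sub_mem hE h))
  · intro hh i X hX
    rw [hE.mem_iff]
    conv_lhs => rw [← hh]
    rw [← Ad_lie, hE.lie_eq i X hX, map_smul]

omit [T2Space G] in
theorem IsParabolic.Ad_eq_neg [LieAlgebra.IsSemisimple ℝ (GroupLieAlgebra (𝓡 n) G)]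
    (hE : GradingElement 𝔤.gr E) (g : G)
    (hg : ∀ X : GroupLieAlgebra (𝓡 n) G, Ad g X + X ∈ 𝔤.filt 0)
    {Z : GroupLieAlgebra (𝓡 n) G} (hZ : Z ∈ 𝔤.gr 1) : Ad g Z = -Z := by
  have : FiniteDimensional ℝ (GroupLieAlgebra (𝓡 n) G) := inferInstanceAs
    (FiniteDimensional ℝ (EuclideanSpace ℝ (Fin n)))
  exact hE.automorphism_eq_neg (AdEquiv g) hg hZ

variable [LieGroup (𝓡 k) ∞ P]

theorem IsParabolic.expIn_add (hP : IsParabolic (k := k) 𝔤 P) (hE : GradingElement 𝔤.gr E)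
    {Y Z : GroupLieAlgebra (𝓡 n) G} (hY : Y ∈ 𝔤.gr 1) (hZ : Z ∈ 𝔤.gr 1) :
    expIn P (Y + Z) = expIn P Y * expIn P Z := by
  apply Subtype.ext
  rw [Subgroup.coe_mul, hP.coe_expIn hY, hP.coe_expIn hZ, hP.coe_expIn (add_mem hY hZ),
    lieExp_add (hE.lie_one_one hY hZ)]

theorem IsParabolic.expIn_zero (hP : IsParabolic (k := k) 𝔤 P) :
    expIn P (0 : GroupLieAlgebra (𝓡 n) G) = 1 := by
  apply Subtype.ext
  rw [hP.coe_expIn (zero_mem _), lieExp_zero]; rfl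

theorem IsParabolic.Ad_expIn (hP : IsParabolic (k := k) 𝔤 P) (hE : GradingElement 𝔤.gr E)
    {Y Z : GroupLieAlgebra (𝓡 n) G} (hZ : Z ∈ 𝔤.gr 1) (hY : Y ∈ 𝔤.gr 1) :
    Ad (expIn P Z : G) Y = Y := by
  rw [hP.coe_expIn hZ, Ad_lieExp_of_lie_eq_zero (hE.lie_one_one hZ hY)]

/-- Since `⁅Z, ⁅Z, E⁆⁆ = 0`, the exponential series stops after the linear term. So `exp 𝔤₁` acts
simply transitively on `E + 𝔤₁`, and `Z` can be read off from `exp Z`. -/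
theorem IsParabolic.Ad_expIn_gradingElement (hP : IsParabolic (k := k) 𝔤 P)
    (hE : GradingElement 𝔤.gr E) {Z : GroupLieAlgebra (𝓡 n) G} (hZ : Z ∈ 𝔤.gr 1) :
    Ad (expIn P Z : G) E = E - Z := by
  have h1 : ⁅Z, E⁆ = -Z := by rw [← lie_skew, hE.lie_one hZ]
  rw [hP.coe_expIn hZ, Ad_lieExp_of_lie_lie_eq_zero (by rw [h1, lie_neg, lie_self, neg_zero]), h1,
    sub_eq_add_neg]

theorem IsParabolic.expIn_injOn (hP : IsParabolic (k := k) 𝔤 P) (hE : GradingElement 𝔤.gr E)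
    {Y Z : GroupLieAlgebra (𝓡 n) G} (hY : Y ∈ 𝔤.gr 1) (hZ : Z ∈ 𝔤.gr 1)
    (h : expIn P Y = expIn P Z) : Y = Z := by
  have h1 := hP.Ad_expIn_gradingElement hE hY
  rw [h, hP.Ad_expIn_gradingElement hE hZ] at h1
  exact (sub_right_inj.1 h1).symm

theorem IsParabolic.expIn_mul (hP : IsParabolic (k := k) 𝔤 P) (hE : GradingElement 𝔤.gr E)
    {Z : GroupLieAlgebra (𝓡 n) G} (hZ : Z ∈ 𝔤.gr 1) (h : P) :
    expIn P Z * h = h * expIn P (Ad ((h : G)⁻¹) Z) := by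
  apply Subtype.ext
  have h1 : Ad ((h : G)⁻¹) Z ∈ 𝔤.gr 1 := hP.Ad_mem_gr_one hE h⁻¹ hZ
  rw [Subgroup.coe_mul, Subgroup.coe_mul, hP.coe_expIn hZ, hP.coe_expIn h1, ← conj_lieExp]
  group

/-- This is the decomposition `P = G₀ · exp 𝔤₁`: the exponential factor moves `E` to `Ad h⁻¹ E`, so
its product with `h` fixes `E`. -/
theorem IsParabolic.mul_expIn_mem_G0 [LieAlgebra.IsSemisimple ℝ (GroupLieAlgebra (𝓡 n) G)]
    (hP : IsParabolic (k := k) 𝔤 P) (hE : GradingElement 𝔤.gr E) (h : P) :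
    E - Ad ((h : G)⁻¹) E ∈ 𝔤.gr 1 ∧ h * expIn P (E - Ad ((h : G)⁻¹) E) ∈ 𝔤.G0 P := by
  have h1 : E - Ad ((h : G)⁻¹) E ∈ 𝔤.gr 1 := by
    rw [← neg_mem_iff, neg_sub]
    exact hP.Ad_sub_mem hE h⁻¹
  refine ⟨h1, (hP.mem_G0_iff hE _).2 ?_⟩
  rw [Subgroup.coe_mul, Ad_mul_apply, hP.Ad_expIn_gradingElement hE h1, sub_sub_cancel, Ad_Ad_inv]

end Structure

end Parabolic

end WeylSym

namespace WeylSym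

open Filter Topology

/-! ### Principal bundles: fibre coordinates and vertical vectors -/

section Principal

variable {b k m : ℕ} {P : Type*} [TopologicalSpace P] [ChartedSpace (EuclideanSpace ℝ (Fin k)) P]
  [Group P] {B : Type*} [TopologicalSpace B] [ChartedSpace (EuclideanSpace ℝ (Fin b)) B]
  {M : Type*} [TopologicalSpace M] [ChartedSpace (EuclideanSpace ℝ (Fin m)) M]
  (C : PrincipalBundle (b := b) (k := k) (m := m) P B M)

namespace PrincipalBundle

theorem isOpen_preimage {U : Set M} (hU : IsOpen U) : IsOpen (C.proj ⁻¹' U) :=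
  hU.preimage C.contMDiff_proj.continuous

@[simp] theorem act_act_inv (u : B) (g : P) : C.act (C.act u g) g⁻¹ = u := by
  rw [← C.act_mul, mul_inv_cancel, C.act_one]

/-- Around each point there is a smooth equivariant map to the structure group whose level sets
are the values of a local section. -/
theorem exists_local_fibreCoordinate (x : M) : ∃ (U : Set M) (e : M × P → B) (A : B → P),
    IsOpen U ∧ x ∈ U ∧ ContMDiffOn ((𝓡 m).prod (𝓡 k)) (𝓡 b) ∞ e (U ×ˢ univ) ∧
    ContMDiffOn (𝓡 b) (𝓡 k) ∞ A (C.proj ⁻¹' U) ∧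
    (∀ u, C.proj u ∈ U → e (C.proj u, A u) = u) ∧
    (∀ y ∈ U, ∀ g h, e (y, g * h) = C.act (e (y, g)) h) ∧
    (∀ u, C.proj u ∈ U → ∀ h, A (C.act u h) = A u * h) := by
  obtain ⟨U, e, hU, hx, hs, ht, he, hes, hact⟩ := C.locally_trivial x
  have h1 : ∀ u, C.proj u ∈ U → (e.symm u).1 = C.proj u ∧ e (C.proj u, (e.symm u).2) = u := by
    intro u hu
    have hu' : u ∈ e.target := by rw [ht]; exact hu
    have h2 := e.map_target hu'
    rw [hs] at h2
    have h3 : e ((e.symm u).1, (e.symm u).2) = u := e.right_inv hu'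
    have h4 := (hact _ h2.1 (e.symm u).2).1
    rw [h3] at h4
    exact ⟨h4.symm, by rw [h4]; exact h3⟩
  refine ⟨U, e, fun u => (e.symm u).2, hU, hx, by rw [← hs]; exact he, ?_, fun u hu => (h1 u hu).2,
    fun y hy g h => (hact y hy g).2 h, fun u hu h => ?_⟩
  · rw [← ht]
    exact contMDiff_snd.comp_contMDiffOn hes
  · have hu' : C.proj (C.act u h) ∈ U := by rw [C.proj_act]; exact hu
    have h2 := (h1 _ hu').2
    rw [C.proj_act] at h2
    have h3 := (hact _ hu (e.symm u).2).2 h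
    rw [(h1 u hu).2, ← h2] at h3
    have h4 := e.injOn (by rw [hs]; exact ⟨hu, mem_univ _⟩) (by rw [hs]; exact ⟨hu, mem_univ _⟩) h3
    exact (congrArg Prod.snd h4).symm

theorem act_injective (u : B) : Injective (C.act u) := by
  intro g h hgh
  obtain ⟨U, e, A, -, hx, -, -, -, -, hA⟩ := C.exists_local_fibreCoordinate (C.proj u)
  have := congrArg A hgh
  rw [hA u hx, hA u hx] at this
  exact mul_left_cancel this

theorem exists_act_eq {u v : B} (h : C.proj u = C.proj v) : ∃ g, C.act u g = v := by
  obtain ⟨U, e, A, -, hx, -, -, he, hact, -⟩ := C.exists_local_fibreCoordinate (C.proj u)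
  refine ⟨(A u)⁻¹ * A v, ?_⟩
  have h1 := hact _ hx (A u) ((A u)⁻¹ * A v)
  rw [mul_inv_cancel_left, he u hx, h, he v (h ▸ hx)] at h1
  exact h1.symm

/-- The group-valued function comparing two smooth maps to the total space is smooth. -/
theorem contMDiffOn_of_act_eq [LieGroup (𝓡 k) ∞ P] {E₁ H₁ N : Type*} [NormedAddCommGroup E₁]
    [NormedSpace ℝ E₁] [TopologicalSpace H₁] {J : ModelWithCorners ℝ E₁ H₁} [TopologicalSpace N]
    [ChartedSpace H₁ N] {s : Set N} {f₁ f₂ : N → B} {g : N → P}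
    (hf₁ : ContMDiffOn J (𝓡 b) ∞ f₁ s) (hf₂ : ContMDiffOn J (𝓡 b) ∞ f₂ s)
    (h : ∀ x ∈ s, C.act (f₁ x) (g x) = f₂ x) : ContMDiffOn J (𝓡 k) ∞ g s := by
  intro x hx
  obtain ⟨U, e, A, hU, hxU, -, hAs, -, -, hA⟩ := C.exists_local_fibreCoordinate (C.proj (f₁ x))
  have hpr : ∀ y ∈ s, C.proj (f₁ y) = C.proj (f₂ y) := fun y hy => by rw [← h y hy, C.proj_act]
  have hnhds : ∀ {u : B}, C.proj u ∈ U → C.proj ⁻¹' U ∈ 𝓝 u := fun hu =>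
    (C.isOpen_preimage hU).mem_nhds hu
  have h1 : ContMDiffWithinAt J (𝓡 k) ∞ (fun y => (A (f₁ y))⁻¹ * A (f₂ y)) s x :=
    ((hAs.contMDiffAt (hnhds hxU)).comp_contMDiffWithinAt x (hf₁ x hx)).inv.mul
      ((hAs.contMDiffAt (hnhds (hpr x hx ▸ hxU))).comp_contMDiffWithinAt x (hf₂ x hx))
  have h2 : ∀ᶠ y in 𝓝[s] x, C.proj (f₁ y) ∈ U :=
    (hf₁ x hx).continuousWithinAt.preimage_mem_nhdsWithin (hnhds hxU)
  have h3 : ∀ y ∈ s, C.proj (f₁ y) ∈ U → g y = (A (f₁ y))⁻¹ * A (f₂ y) := fun y hy hyU => by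
    rw [← h y hy, hA _ hyU, inv_mul_cancel_left]
  refine h1.congr_of_eventuallyEq ?_ (h3 x hx hxU)
  filter_upwards [h2, self_mem_nhdsWithin] with y hy hys using h3 y hys hy

theorem contMDiff_act_right [LieGroup (𝓡 k) ∞ P] (g : P) :
    ContMDiff (𝓡 b) (𝓡 b) ∞ (fun u => C.act u g) :=
  C.contMDiff_act.comp (contMDiff_id.prodMk contMDiff_const)

theorem contMDiff_act_left (u : B) : ContMDiff (𝓡 k) (𝓡 b) ∞ (C.act u) :=
  C.contMDiff_act.comp (contMDiff_const.prodMk contMDiff_id)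

/-- Vertical vectors are values of fundamental vector fields. -/
theorem exists_eq_modelDeriv_act [LieGroup (𝓡 k) ∞ P] {u : B} {v : Eu b}
    (hv : modelDeriv b m C.proj u v = 0) : ∃ X : Eu k, v = modelDeriv k b (C.act u) 1 X := by
  obtain ⟨U, e, A, hU, hx, hes, hAs, he, hact, hA⟩ := C.exists_local_fibreCoordinate (C.proj u)
  have hnhds : C.proj ⁻¹' U ∈ 𝓝 u := (C.isOpen_preimage hU).mem_nhds hx
  have hpd : MDifferentiableAt (𝓡 b) (𝓡 m) C.proj u :=
    C.contMDiff_proj.mdifferentiableAt (by simp)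
  have hAd : MDifferentiableAt (𝓡 b) (𝓡 k) A u :=
    (hAs.contMDiffAt hnhds).mdifferentiableAt (by simp)
  have hed : MDifferentiableAt ((𝓡 m).prod (𝓡 k)) (𝓡 b) e (C.proj u, A u) :=
    (hes.contMDiffAt ((hU.prod isOpen_univ).mem_nhds ⟨hx, mem_univ _⟩)).mdifferentiableAt (by simp)
  have h1 := HasMFDerivAt.comp (f := fun u' => (C.proj u', A u')) u hed.hasMFDerivAt
    (hpd.hasMFDerivAt.prodMk hAd.hasMFDerivAt)
  -- Differentiate this identity along `v`: the base component drops out because `v` is vertical,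
  -- and in the fibre `e (proj u, z) = u · ((A u)⁻¹ z)`.
  have h2 : (e ∘ fun u' => (C.proj u', A u')) =ᶠ[𝓝 u] id := by
    filter_upwards [hnhds] with u' hu' using he u' hu'
  have h3 : modelDeriv b b (e ∘ fun u' => (C.proj u', A u')) u v = v := by
    rw [modelDeriv_congr h2, modelDeriv_id]; rfl
  have h4 : modelDeriv b b (e ∘ fun u' => (C.proj u', A u')) u v =
      mfderiv ((𝓡 m).prod (𝓡 k)) (𝓡 b) e (C.proj u, A u)
        ((modelDeriv b m C.proj u v, modelDeriv b k A u v) : Eu m × Eu k) :=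
    congrArg (fun T : Eu b →L[ℝ] Eu b => T v) h1.mfderiv
  have h5 : mfderiv ((𝓡 m).prod (𝓡 k)) (𝓡 b) e (C.proj u, A u)
        ((modelDeriv b m C.proj u v, modelDeriv b k A u v) : Eu m × Eu k) =
      modelDeriv m b (fun z => e (z, A u)) (C.proj u) (modelDeriv b m C.proj u v) +
      modelDeriv k b (fun z => e (C.proj u, z)) (A u) (modelDeriv b k A u v) :=
    mfderiv_prod_eq_add_apply
      (v := ((modelDeriv b m C.proj u v, modelDeriv b k A u v) : Eu m × Eu k)) hed
  have h6 : (fun z => e (C.proj u, z)) = C.act u ∘ ((A u)⁻¹ * ·) := by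
    ext1 z
    have := hact _ hx (A u) ((A u)⁻¹ * z)
    rwa [mul_inv_cancel_left, he u hx] at this
  have h7 := modelDeriv_comp (x := A u) (y := 1)
    ((C.contMDiff_act_left u).mdifferentiableAt (by simp))
    (mdifferentiableAt_mul_left (A u)⁻¹ (A u)) (inv_mul_cancel _)
  refine ⟨modelDeriv k k ((A u)⁻¹ * ·) (A u) (modelDeriv b k A u v), ?_⟩
  rw [h5, hv, map_zero, zero_add, h6, h7] at h4
  exact h3.symm.trans h4

end PrincipalBundle

end Principal

/-! ### The Cartan connection at the centre of a symmetry -/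

section Cartan

variable {n k m : ℕ}
  {G : Type*} [TopologicalSpace G] [ChartedSpace (EuclideanSpace ℝ (Fin n)) G] [Group G]
  {P : Subgroup G} [ChartedSpace (EuclideanSpace ℝ (Fin k)) P]
  {B : Type*} [TopologicalSpace B] [ChartedSpace (EuclideanSpace ℝ (Fin n)) B]
  [IsManifold (𝓡 n) ∞ B]
  {M : Type*} [TopologicalSpace M] [ChartedSpace (EuclideanSpace ℝ (Fin m)) M]
  (C : CartanGeometry (n := n) (k := k) (m := m) P B M)

/-- The Cartan connection, read in the model spaces. -/
def CartanGeometry.modelConn (u : B) : Eu n →L[ℝ] Eu n := C.conn u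

variable [LieGroup (𝓡 n) ∞ G] [LieGroup (𝓡 k) ∞ P] {𝔤 : OneGrading (n := n) G}

theorem CartanGeometry.conn_mem_of_vertical (hP : IsParabolic (k := k) 𝔤 P) {u : B} {v : Eu n}
    (hv : modelDeriv n m C.proj u v = 0) : ofModel G (C.modelConn u v) ∈ 𝔤.filt 0 := by
  obtain ⟨X, hX⟩ := C.exists_eq_modelDeriv_act hv
  have h1 : C.modelConn (C.act u 1) (modelDeriv k n (C.act u) 1 X) =
      modelDeriv k n (Subtype.val : P → G) 1 X := C.fundamental u (ofModel P X)
  rw [C.act_one, ← hX] at h1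
  rw [h1]
  have h2 : ofModel G (modelDeriv k n (Subtype.val : P → G) 1 X) ∈
      (𝔤.filt 0 : Set (GroupLieAlgebra (𝓡 n) G)) := by
    rw [← hP.lieAlgebra_eq]; exact ⟨X, rfl⟩
  exact h2

/-- If a symmetry with centre `x` maps `u` to `u · h` in the fibre over `x`, then `Ad h` induces
`-id` on `𝔤/𝔭`. -/
theorem LocalAut.CoversSymmetryAt.Ad_add_mem {C : CartanGeometry (n := n) (k := k) (m := m) P B M}
    {Φ : LocalAut C} {x : M} (hΦ : Φ.CoversSymmetryAt x) (hP : IsParabolic (k := k) 𝔤 P)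
    {u : B} (hu : C.proj u = x) {h : P} (hh : C.act u h = Φ.φ u)
    (X : GroupLieAlgebra (𝓡 n) G) : Ad (h : G) X + X ∈ 𝔤.filt 0 := by
  obtain ⟨hxs, hbx, hT⟩ := hΦ
  have hus : u ∈ Φ.φ.source := by rw [Φ.source_eq]; exact (hu.symm ▸ hxs : C.proj u ∈ _)
  have hsn : Φ.φ.source ∈ 𝓝 u := Φ.φ.open_source.mem_nhds hus
  obtain ⟨v, hv⟩ : ∃ v : Eu n, ofModel G (C.modelConn u v) = X := (C.bijective u).2 X
  have hφd : MDifferentiableAt (𝓡 n) (𝓡 n) Φ.φ u :=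
    (Φ.contMDiffOn_φ.contMDiffAt hsn).mdifferentiableAt (by simp)
  have hrd : MDifferentiableAt (𝓡 n) (𝓡 n) (fun u' => C.act u' h⁻¹) (Φ.φ u) :=
    (C.contMDiff_act_right h⁻¹).mdifferentiableAt (by simp)
  have hpd : ∀ u', MDifferentiableAt (𝓡 n) (𝓡 m) C.proj u' := fun u' =>
    C.contMDiff_proj.mdifferentiableAt (by simp)
  have hbd : MDifferentiableAt (𝓡 m) (𝓡 m) Φ.base x :=
    (Φ.contMDiffOn_base.contMDiffAt (Φ.base.open_source.mem_nhds hxs)).mdifferentiableAt (by simp)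
  -- Moving `v` by `φ` and then by right translation with `h⁻¹` gives a vector at `u` again. It
  -- satisfies `ω(w) = Ad h X` and projects to minus the projection of `v`, so `w + v` is vertical.
  set w : Eu n := modelDeriv n n (fun u' => C.act u' h⁻¹) (Φ.φ u) (modelDeriv n n Φ.φ u v) with hw
  have hback : C.act (Φ.φ u) h⁻¹ = u := by rw [← hh, C.act_act_inv]
  have h1 : C.modelConn u w = toModel (Ad (h : G) X) := by
    have e1 : C.modelConn (C.act (Φ.φ u) h⁻¹) w =
        toModel (Ad (((h⁻¹ : P) : G)⁻¹) (ofModel G (C.modelConn (Φ.φ u) (modelDeriv n n Φ.φ u v)))) :=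
      C.equivariant h⁻¹ (Φ.φ u) (modelDeriv n n Φ.φ u v)
    have e2 : ofModel G (C.modelConn (Φ.φ u) (modelDeriv n n Φ.φ u v)) = X :=
      (Φ.preserves_conn u hus v).trans hv
    rw [hback, e2] at e1
    simpa using e1
  have h2 : modelDeriv n m C.proj u w = - modelDeriv n m C.proj u v := by
    have e1 : C.proj ∘ (fun u' => C.act u' h⁻¹) ∘ Φ.φ =ᶠ[𝓝 u] Φ.base ∘ C.proj := by
      filter_upwards [hsn] with u' hu'
      simp only [comp_apply, C.proj_act, Φ.covers u' hu']
    have e2 := modelDeriv_congr (a := n) (b := m) e1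
    rw [modelDeriv_comp (y := u) (hpd u) (hrd.comp u hφd) hback,
      modelDeriv_comp hrd hφd rfl, modelDeriv_comp hbd (hpd u) hu] at e2
    have e3 := congrArg (fun T => T v) e2
    have e4 : ∀ z : Eu m, modelDeriv m m Φ.base x z = -z := fun z =>
      congrArg (fun p : TangentBundle (𝓡 m) M => (show Eu m from p.2)) (hT z)
    exact e3.trans (e4 _)
  have h3 := C.conn_mem_of_vertical hP (u := u) (v := w + v) (by rw [map_add, h2, neg_add_cancel])
  rw [map_add, h1] at h3
  have h4 : ofModel G (toModel (Ad (h : G) X) + C.modelConn u v) = Ad (h : G) X + X :=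
    congrArg (fun Y => Ad (h : G) X + Y) hv
  rwa [h4] at h3

end Cartan

end WeylSym

namespace WeylSym

open Filter Topology

/-! ### Weyl structures as equivariant functions -/

section WeylFunctions

variable {n k m : ℕ}
  {G : Type*} [TopologicalSpace G] [ChartedSpace (EuclideanSpace ℝ (Fin n)) G] [Group G]
  [LieGroup (𝓡 n) ∞ G]
  {P : Subgroup G} [ChartedSpace (EuclideanSpace ℝ (Fin k)) P]
  {B : Type*} [TopologicalSpace B] [ChartedSpace (EuclideanSpace ℝ (Fin n)) B]
  [IsManifold (𝓡 n) ∞ B]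
  {M : Type*} [TopologicalSpace M] [ChartedSpace (EuclideanSpace ℝ (Fin m)) M]

/-- `P`-equivariant functions over `U` with values in `E + 𝔤₁`, where `E` is the grading element.
They correspond to Weyl structures over `U`. -/
structure IsWeylFun (𝔤 : OneGrading (n := n) G)
    (C : CartanGeometry (n := n) (k := k) (m := m) P B M) (E : GroupLieAlgebra (𝓡 n) G)
    (U : Set M) (F : B → GroupLieAlgebra (𝓡 n) G) : Prop where
  mem : ∀ u, C.proj u ∈ U → E - F u ∈ 𝔤.gr 1
  equivariant : ∀ u, C.proj u ∈ U → ∀ h : P, F (C.act u h) = Ad ((h : G)⁻¹) (F u)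
  smooth : ContMDiffOn (𝓡 n) (𝓡 n) ∞ (fun u => toModel (F u)) (C.proj ⁻¹' U)

/-- The function `F` represents the Weyl structure `σ` over `U`. -/
def Represents (𝔤 : OneGrading (n := n) G)
    (C : CartanGeometry (n := n) (k := k) (m := m) P B M) (E : GroupLieAlgebra (𝓡 n) G)
    (U : Set M) (F : B → GroupLieAlgebra (𝓡 n) G) (σ : Under 𝔤 C → B) : Prop :=
  ∀ u, C.proj u ∈ U → σ (Under.mk 𝔤 C u) = C.act u (expIn P (E - F u))

variable {𝔤 : OneGrading (n := n) G} {C : CartanGeometry (n := n) (k := k) (m := m) P B M}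
  {E : GroupLieAlgebra (𝓡 n) G} {U V : Set M} {F F' : B → GroupLieAlgebra (𝓡 n) G}
  {σ : Under 𝔤 C → B}

theorem Under.exists_mk (q : Under 𝔤 C) : ∃ u, Under.mk 𝔤 C u = q ∧ C.proj u = q.proj := by
  induction q using Quot.ind with
  | mk u => exact ⟨u, rfl, rfl⟩

namespace IsWeylFun

theorem congr (hF : IsWeylFun 𝔤 C E U F) (h : ∀ u, C.proj u ∈ U → F' u = F u) :
    IsWeylFun 𝔤 C E U F' where
  mem u hu := by rw [h u hu]; exact hF.mem u hu
  equivariant u hu g := by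
    rw [h u hu, h _ (by rwa [C.proj_act]), hF.equivariant u hu]
  smooth := hF.smooth.congr fun u hu => by rw [h u hu]

theorem union (hU : IsOpen U) (hV : IsOpen V) (h : IsWeylFun 𝔤 C E U F)
    (h' : IsWeylFun 𝔤 C E V F) : IsWeylFun 𝔤 C E (U ∪ V) F where
  mem u hu := hu.elim (h.mem u) (h'.mem u)
  equivariant u hu := hu.elim (h.equivariant u) (h'.equivariant u)
  smooth := by
    rw [preimage_union]
    exact h.smooth.union_of_isOpen h'.smooth (C.isOpen_preimage hU) (C.isOpen_preimage hV)

/-- Weyl functions form an affine space. -/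
theorem sub_smul (h : IsWeylFun 𝔤 C E U F) (h' : IsWeylFun 𝔤 C E U F') {ρ : M → ℝ}
    (hρ : ContMDiffOn (𝓡 m) 𝓘(ℝ, ℝ) ∞ ρ U) :
    IsWeylFun 𝔤 C E U (fun u => F u - ρ (C.proj u) • (F u - F' u)) where
  mem u hu := by
    have : E - (F u - ρ (C.proj u) • (F u - F' u)) =
        (E - F u) + ρ (C.proj u) • ((E - F' u) - (E - F u)) := by module
    rw [this]
    exact add_mem (h.mem u hu) (Submodule.smul_mem _ _ (sub_mem (h'.mem u hu) (h.mem u hu)))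
  equivariant u hu g := by
    rw [h.equivariant u hu, h'.equivariant u hu, C.proj_act, map_sub, map_smul, map_sub]
  smooth := by
    have h1 : ContMDiffOn (𝓡 n) 𝓘(ℝ, ℝ) ∞ (fun u => ρ (C.proj u)) (C.proj ⁻¹' U) :=
      hρ.comp C.contMDiff_proj.contMDiffOn (fun _ hu => hu)
    exact h.smooth.sub (h1.smul (h.smooth.sub h'.smooth))

/-- The pullback of a Weyl function by a local automorphism. -/
theorem comp_localAut (h : IsWeylFun 𝔤 C E V F) (Φ : LocalAut C)
    (hU : ∀ y ∈ U, y ∈ Φ.base.source ∧ Φ.base y ∈ V) :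
    IsWeylFun 𝔤 C E U (fun u => F (Φ.φ u)) := by
  have hs : ∀ u, C.proj u ∈ U → u ∈ Φ.φ.source := fun u hu => by
    rw [Φ.source_eq]; exact (hU _ hu).1
  have hV : ∀ u, C.proj u ∈ U → C.proj (Φ.φ u) ∈ V := fun u hu => by
    rw [Φ.covers u (hs u hu)]; exact (hU _ hu).2
  refine ⟨fun u hu => h.mem _ (hV u hu), fun u hu g => ?_, ?_⟩
  · rw [Φ.map_act u (hs u hu), h.equivariant _ (hV u hu)]
  · exact h.smooth.comp (Φ.contMDiffOn_φ.mono hs) hV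

end IsWeylFun

/-- Thus `F ∘ φ` represents the pullback: by equivariance `φ⁻¹` undoes `φ` and leaves only the
exponential factor. -/
theorem LocalAut.pullback_mk (Φ : LocalAut C) (hr : Represents 𝔤 C E V F σ) {u : B}
    (hu : C.proj u ∈ Φ.base.source) (huV : Φ.base (C.proj u) ∈ V) :
    Φ.pullback σ (Under.mk 𝔤 C u) = C.act u (expIn P (E - F (Φ.φ u))) := by
  have hs : u ∈ Φ.φ.source := by rw [Φ.source_eq]; exact hu
  have h1 : ∀ g, C.act u g ∈ Φ.φ.source := fun g => by
    rw [Φ.source_eq, mem_preimage, C.proj_act]; exact hu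
  rw [LocalAut.pullback, Φ.underMap_mk hs, hr _ (by rwa [Φ.covers u hs]), ← Φ.map_act u hs,
    Φ.φ.left_inv (h1 _)]

variable [T2Space G] [LieGroup (𝓡 k) ∞ P]

theorem IsParabolic.expIn_neg (hP : IsParabolic (k := k) 𝔤 P) (hE : GradingElement 𝔤.gr E)
    {Z : GroupLieAlgebra (𝓡 n) G} (hZ : Z ∈ 𝔤.gr 1) : expIn P (-Z) = (expIn P Z)⁻¹ := by
  rw [eq_inv_iff_mul_eq_one, ← hP.expIn_add hE (neg_mem hZ) hZ, neg_add_cancel, hP.expIn_zero]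

/-- `exp 𝔤₁` is a group, so `PlusRel` already coincides with the equivalence relation it generates.
-/
theorem Under.mk_eq_mk_iff (hP : IsParabolic (k := k) 𝔤 P) (hE : GradingElement 𝔤.gr E)
    {u v : B} : Under.mk 𝔤 C u = Under.mk 𝔤 C v ↔ ∃ Z ∈ 𝔤.gr 1, v = C.act u (expIn P Z) := by
  refine ⟨fun h => ?_, fun h => Quot.sound h⟩
  have := Quot.eqvGen_exact h
  induction this with
  | rel _ _ h' => exact h'
  | refl a => exact ⟨0, zero_mem _, by rw [hP.expIn_zero, C.act_one]⟩
  | symm a b _ ih =>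
    obtain ⟨Z, hZ, rfl⟩ := ih (h.symm)
    exact ⟨-Z, neg_mem hZ, by rw [hP.expIn_neg hE hZ, C.act_act_inv]⟩
  | trans a b c hab hbc ih1 ih2 =>
    obtain ⟨Z, hZ, rfl⟩ := ih1 (Quot.eqvGen_sound hab)
    obtain ⟨Y, hY, rfl⟩ := ih2 (Quot.eqvGen_sound hbc)
    exact ⟨Z + Y, add_mem hZ hY, by rw [hP.expIn_add hE hZ hY, C.act_mul]⟩

theorem act_expIn_injOn (hP : IsParabolic (k := k) 𝔤 P) (hE : GradingElement 𝔤.gr E) {u : B}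
    {Y Z : GroupLieAlgebra (𝓡 n) G} (hY : Y ∈ 𝔤.gr 1) (hZ : Z ∈ 𝔤.gr 1)
    (h : C.act u (expIn P Y) = C.act u (expIn P Z)) : Y = Z :=
  hP.expIn_injOn hE hY hZ (C.act_injective u h)

theorem IsParabolic.Ad_expIn_inv (hP : IsParabolic (k := k) 𝔤 P) (hE : GradingElement 𝔤.gr E)
    {X Z : GroupLieAlgebra (𝓡 n) G} (hX : E - X ∈ 𝔤.gr 1) (hZ : Z ∈ 𝔤.gr 1) :
    Ad ((expIn P Z : G)⁻¹) X = X + Z := by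
  have h1 : ((expIn P Z : G)⁻¹) = (expIn P (-Z) : G) := by
    rw [hP.expIn_neg hE hZ, Subgroup.coe_inv]
  have h2 : X = E - (E - X) := by abel
  rw [h1]
  conv_lhs => rw [h2]
  rw [map_sub, hP.Ad_expIn_gradingElement hE (neg_mem hZ), hP.Ad_expIn hE (neg_mem hZ) hX]
  abel

theorem IsWeylFun.act_expIn (hP : IsParabolic (k := k) 𝔤 P) (hE : GradingElement 𝔤.gr E)
    (hF : IsWeylFun 𝔤 C E U F) {u : B} (hu : C.proj u ∈ U) {Z : GroupLieAlgebra (𝓡 n) G}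
    (hZ : Z ∈ 𝔤.gr 1) : F (C.act u (expIn P Z)) = F u + Z := by
  rw [hF.equivariant u hu, hP.Ad_expIn_inv hE (hF.mem u hu) hZ]

/-- The point `u · exp (E - F u)` depends only on the class of `u`, because `F (u · exp Z) = F u +
Z`. -/
theorem IsWeylFun.exists_represents (hP : IsParabolic (k := k) 𝔤 P)
    (hE : GradingElement 𝔤.gr E) (hF : IsWeylFun 𝔤 C E U F) :
    ∃ σ : Under 𝔤 C → B, Represents 𝔤 C E U F σ := by
  choose r hr _ using fun q : Under 𝔤 C => q.exists_mk
  refine ⟨fun q => C.act (r q) (expIn P (E - F (r q))), fun u hu => ?_⟩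
  obtain ⟨Z, hZ, h⟩ := (Under.mk_eq_mk_iff hP hE).1 (hr (Under.mk 𝔤 C u)).symm
  simp only
  rw [h, hF.act_expIn hP hE hu hZ, ← C.act_mul, ← sub_sub, ← hP.expIn_add hE hZ
    (sub_mem (hF.mem u hu) hZ), add_sub_cancel]

variable [LieAlgebra.IsSemisimple ℝ (GroupLieAlgebra (𝓡 n) G)]

theorem IsWeylFun.isWeylOn (hP : IsParabolic (k := k) 𝔤 P) (hE : GradingElement 𝔤.gr E)
    (hF : IsWeylFun 𝔤 C E U F) (hr : Represents 𝔤 C E U F σ) : IsWeylOn U σ where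
  isSection q hq := by
    obtain ⟨u, rfl, hu⟩ := q.exists_mk
    rw [hr u (hu ▸ hq)]
    exact (Quot.sound ⟨_, hF.mem u (hu ▸ hq), rfl⟩ : Under.mk 𝔤 C u = _).symm
  equivariant u hu h hh := by
    have h1 : Ad ((h : G)⁻¹) E = E := by
      conv_lhs => rw [← (hP.mem_G0_iff hE h).1 hh, Ad_inv_Ad]
    have h2 : E - Ad ((h : G)⁻¹) (F u) = Ad ((h : G)⁻¹) (E - F u) := by rw [map_sub, h1]
    rw [hr _ (by rwa [C.proj_act]), hr u hu, hF.equivariant u hu, h2, ← C.act_mul, ← C.act_mul,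
      hP.expIn_mul hE (hF.mem u hu)]
  smooth := by
    have h1 : ContMDiffOn (𝓡 n) (𝓡 k) ∞ (fun u => expIn P (E - F u)) (C.proj ⁻¹' U) :=
      contMDiffOn_expIn hP (fun X hX Y hY => hE.lie_one_one hX hY) (fun u hu => hF.mem u hu)
        (contMDiffOn_const.sub hF.smooth)
    exact (C.contMDiff_act.comp_contMDiffOn (contMDiffOn_id.prodMk h1)).congr fun u hu => hr u hu

/-- Take `F = E - Z`, where `σ (π u) = u · exp (Z u)`. Equivariance under `G₀` comes from that of
`σ`, and under `exp 𝔤₁` from the definition of `Z`; together these generate `P`. -/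
theorem IsWeylOn.exists_isWeylFun (hP : IsParabolic (k := k) 𝔤 P) (hE : GradingElement 𝔤.gr E)
    (hσ : IsWeylOn U σ) :
    ∃ F, IsWeylFun 𝔤 C E U F ∧ Represents 𝔤 C E U F σ := by
  have h1 : ∀ u, ∃ Z ∈ 𝔤.gr 1, C.proj u ∈ U →
      σ (Under.mk 𝔤 C u) = C.act u (expIn P Z) := by
    intro u
    by_cases hu : C.proj u ∈ U
    · obtain ⟨Z, hZ, h⟩ := (Under.mk_eq_mk_iff hP hE).1 (hσ.isSection (Under.mk 𝔤 C u) hu).symm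
      exact ⟨Z, hZ, fun _ => h⟩
    · exact ⟨0, zero_mem _, fun h => absurd h hu⟩
  choose Z hZ hσZ using h1
  have hG0 : ∀ u, C.proj u ∈ U → ∀ h ∈ 𝔤.G0 P, Z (C.act u h) = Ad ((h : G)⁻¹) (Z u) := by
    intro u hu h hh
    have h1 := hσ.equivariant u hu h hh
    rw [hσZ u hu, hσZ _ (by rwa [C.proj_act]), ← C.act_mul u (expIn P (Z u)) h,
      hP.expIn_mul hE (hZ u), C.act_mul] at h1
    exact act_expIn_injOn hP hE (hZ _) (hP.Ad_mem_gr_one hE h⁻¹ (hZ u)) h1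
  have hexp : ∀ u, C.proj u ∈ U → ∀ Y ∈ 𝔤.gr 1, Z (C.act u (expIn P Y)) = Z u - Y := by
    intro u hu Y hY
    have h1 : Under.mk 𝔤 C u = Under.mk 𝔤 C (C.act u (expIn P Y)) := Quot.sound ⟨Y, hY, rfl⟩
    have h2 := hσZ u hu
    rw [h1, hσZ _ (by rwa [C.proj_act]), ← C.act_mul, ← hP.expIn_add hE hY (hZ _)] at h2
    rw [← act_expIn_injOn hP hE (add_mem hY (hZ _)) (hZ u) h2, add_sub_cancel_left]
  have hmem : ∀ u, E - (E - Z u) ∈ 𝔤.gr 1 := fun u => by rw [sub_sub_cancel]; exact hZ u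
  refine ⟨fun u => E - Z u, ⟨fun u _ => hmem u, fun u hu h => ?_, ?_⟩, fun u hu => ?_⟩
  · obtain ⟨hY, hg⟩ := hP.mul_expIn_mem_G0 hE h
    set Y := E - Ad ((h : G)⁻¹) E with hYdef
    set g := h * expIn P Y with hgdef
    have h1 : h = g * expIn P (-Y) := by
      rw [hP.expIn_neg hE hY, hgdef, mul_inv_cancel_right]
    have h2 : Ad ((g : G)⁻¹) E = E := by
      conv_lhs => rw [← (hP.mem_G0_iff hE g).1 hg, Ad_inv_Ad]
    have h3 : E - Z (C.act u h) = (E - Ad ((g : G)⁻¹) (Z u)) + -Y := by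
      conv_lhs => rw [h1, C.act_mul]
      rw [hexp _ (by rwa [C.proj_act]) _ (neg_mem hY), hG0 u hu g hg]
      abel
    have h4 : (h : G)⁻¹ = (expIn P (-Y) : G)⁻¹ * (g : G)⁻¹ := by
      rw [h1, Subgroup.coe_mul, mul_inv_rev]
    have h5 : E - (E - Ad ((g : G)⁻¹) (Z u)) ∈ 𝔤.gr 1 := by
      rw [sub_sub_cancel]; exact hP.Ad_mem_gr_one hE g⁻¹ (hZ u)
    rw [h3, h4, Ad_mul_apply, map_sub, h2, hP.Ad_expIn_inv hE h5 (neg_mem hY)]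
  -- No logarithm is needed: `exp Z` is smooth because it compares `u` with `σ (π u)`, and `E - Z =
  -- Ad (exp Z) E`.
  · have h1 : ContMDiffOn (𝓡 n) (𝓡 k) ∞ (fun u => expIn P (Z u)) (C.proj ⁻¹' U) :=
      C.contMDiffOn_of_act_eq contMDiffOn_id hσ.smooth (fun u hu => (hσZ u hu).symm)
    have h2 : ContMDiff (𝓡 k) (𝓡 n) ∞ (fun h : P => toModel (Ad (h : G) E)) :=
      (contMDiff_Ad_apply E).comp hP.contMDiff_val
    refine (h2.comp_contMDiffOn h1).congr fun u _ => ?_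
    simp only [comp_apply, hP.Ad_expIn_gradingElement hE (hZ u)]
  · rw [sub_sub_cancel]; exact hσZ u hu

/-- Weyl functions exist locally. -/
theorem exists_isWeylFun_nhds (hP : IsParabolic (k := k) 𝔤 P) (hE : GradingElement 𝔤.gr E)
    (x : M) : ∃ (U : Set M) (F : B → GroupLieAlgebra (𝓡 n) G),
      IsOpen U ∧ x ∈ U ∧ IsWeylFun 𝔤 C E U F := by
  obtain ⟨U, -, A, hU, hx, -, hAs, -, -, hA⟩ := C.exists_local_fibreCoordinate x
  -- The fibre coordinate satisfies `A (u · h) = A u * h`, so moving `E` by its inverse gives an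
  -- equivariant function.
  refine ⟨U, fun u => Ad ((A u : G)⁻¹) E, hU, hx, fun u _ => (hP.mul_expIn_mem_G0 hE (A u)).1,
    fun u hu h => ?_, ?_⟩
  · rw [hA u hu, Subgroup.coe_mul, mul_inv_rev, Ad_mul_apply]
  · have h2 : ContMDiff (𝓡 k) (𝓡 n) ∞ (fun h : P => toModel (Ad (h : G)⁻¹ E)) :=
      (contMDiff_Ad_apply E).comp hP.contMDiff_val.inv
    exact h2.comp_contMDiffOn hAs

/-- Values lie in an affine space on which `P` acts affinely, so local Weyl functions can be glued
with a partition of unity on `M`. -/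
theorem exists_isWeylFun_univ [T2Space M] [SecondCountableTopology M] [IsManifold (𝓡 m) ∞ M]
    (hP : IsParabolic (k := k) 𝔤 P) (hE : GradingElement 𝔤.gr E) :
    ∃ F, IsWeylFun 𝔤 C E univ F := by
  have : LocallyCompactSpace M := ChartedSpace.locallyCompactSpace (EuclideanSpace ℝ (Fin m)) M
  choose U F hU hx hF using exists_isWeylFun_nhds (C := C) hP hE
  obtain ⟨ρ, hρ⟩ := SmoothPartitionOfUnity.exists_isSubordinate (𝓡 m) (isClosed_univ (X := M)) U hU
    (fun x _ => mem_iUnion.2 ⟨x, hx x⟩)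
  have hmem : ∀ (y : M), ∀ i ∈ ρ.finsupport y, y ∈ U i := fun y i hi =>
    hρ i (subset_tsupport _ ((ρ.mem_finsupport y).1 hi))
  have hsum : ∀ u, (∑ᶠ i, ρ i (C.proj u) • F i u) =
      ∑ i ∈ ρ.finsupport (C.proj u), ρ i (C.proj u) • F i u := fun u =>
    finsum_eq_sum_of_support_subset _ fun i hi => by
      rw [ρ.coe_finsupport]
      exact fun h => hi (by simp [h])
  refine ⟨fun u => ∑ᶠ i, ρ i (C.proj u) • F i u, fun u _ => ?_, fun u _ h => ?_, ?_⟩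
  · have h1 : E = ∑ i ∈ ρ.finsupport (C.proj u), ρ i (C.proj u) • E := by
      rw [← Finset.sum_smul, ρ.sum_finsupport _ (mem_univ _), one_smul]
    have h2 : E - (∑ᶠ i, ρ i (C.proj u) • F i u) =
        ∑ i ∈ ρ.finsupport (C.proj u), ρ i (C.proj u) • (E - F i u) := by
      simp only [smul_sub, Finset.sum_sub_distrib]
      rw [← h1, hsum]
    rw [h2]
    refine Submodule.sum_mem _ fun i hi => ?_
    exact Submodule.smul_mem _ _ ((hF i).mem u (hmem _ i hi))
  · rw [hsum, hsum, C.proj_act, map_sum]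
    refine Finset.sum_congr rfl fun i hi => ?_
    rw [(hF i).equivariant u (hmem _ i hi), map_smul]
  · have h1 : ∀ i, ContMDiff (𝓡 n) (𝓡 n) ∞ (fun u => ρ i (C.proj u) • toModel (F i u)) := by
      intro i u
      by_cases hu : C.proj u ∈ U i
      · exact ((ρ i).contMDiff.comp C.contMDiff_proj).contMDiffAt.smul
          ((hF i).smooth.contMDiffAt ((C.isOpen_preimage (hU i)).mem_nhds hu))
      -- Outside `U i` nothing is known about `F i`, but the coefficient vanishes near such points.
      · have hu' : C.proj u ∈ (tsupport (ρ i))ᶜ := fun h => hu (hρ i h)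
        refine (contMDiffAt_const (c := (0 : Eu n))).congr_of_eventuallyEq ?_
        filter_upwards [(C.isOpen_preimage (isClosed_tsupport (ρ i)).isOpen_compl).mem_nhds hu']
          with v hv
        rw [image_eq_zero_of_notMem_tsupport hv, zero_smul]
    have h2 : LocallyFinite fun i => support (fun u => ρ i (C.proj u) • toModel (F i u)) :=
      (ρ.locallyFinite.preimage_continuous C.contMDiff_proj.continuous).subset fun i u hu h =>
        hu (by simp only [h, zero_smul])
    exact (contMDiff_finsum h1 h2).contMDiffOn

end WeylFunctions

end WeylSym

namespace WeylSym

open Filter Topology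

/-! ### Invariance at the centre of a symmetry -/

section Symmetries

variable {n k m : ℕ}
  {G : Type*} [TopologicalSpace G] [T2Space G] [ChartedSpace (EuclideanSpace ℝ (Fin n)) G] [Group G]
  [LieGroup (𝓡 n) ∞ G]
  {P : Subgroup G} [ChartedSpace (EuclideanSpace ℝ (Fin k)) P] [LieGroup (𝓡 k) ∞ P]
  {B : Type*} [TopologicalSpace B] [ChartedSpace (EuclideanSpace ℝ (Fin n)) B]
  [IsManifold (𝓡 n) ∞ B]
  {M : Type*} [TopologicalSpace M] [ChartedSpace (EuclideanSpace ℝ (Fin m)) M]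
  {𝔤 : OneGrading (n := n) G} {C : CartanGeometry (n := n) (k := k) (m := m) P B M}
  {E : GroupLieAlgebra (𝓡 n) G} {U V V' : Set M} {F F' : B → GroupLieAlgebra (𝓡 n) G}
  {σ : Under 𝔤 C → B} {Φ : LocalAut C} {x : M}

/-- Over the fixed point `x` the pullback is represented by `F ∘ φ`, and the representing value is
unique since `P` acts freely and `exp` is injective on `𝔤₁`. -/
theorem LocalAut.invariantAt_iff (hP : IsParabolic (k := k) 𝔤 P) (hE : GradingElement 𝔤.gr E)
    (hΦ : Φ.CoversSymmetryAt x) (hx : x ∈ V) (hF : IsWeylFun 𝔤 C E V F)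
    (hr : Represents 𝔤 C E V F σ) :
    Φ.InvariantAt x σ ↔ ∀ u, C.proj u = x → F (Φ.φ u) = F u := by
  have hpb : ∀ u, C.proj u = x →
      Φ.pullback σ (Under.mk 𝔤 C u) = C.act u (expIn P (E - F (Φ.φ u))) := fun u hu =>
    Φ.pullback_mk hr (hu ▸ hΦ.1) (by rw [hu, hΦ.2.1]; exact hx)
  have hV : ∀ u, C.proj u = x → C.proj (Φ.φ u) ∈ V := fun u hu => by
    rw [Φ.covers u (by rw [Φ.source_eq, mem_preimage, hu]; exact hΦ.1), hu, hΦ.2.1]; exact hx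
  constructor
  · intro h u hu
    have h1 := h (Under.mk 𝔤 C u) hu
    rw [hpb u hu, hr u (hu ▸ hx)] at h1
    exact sub_right_injective
      (act_expIn_injOn hP hE (hF.mem _ (hV u hu)) (hF.mem _ (hu ▸ hx)) h1)
  · intro h q hq
    obtain ⟨u, rfl, hu⟩ := q.exists_mk
    rw [hpb u (hu.trans hq), hr u ((hu.trans hq) ▸ hx), h u (hu.trans hq)]

variable [LieAlgebra.IsSemisimple ℝ (GroupLieAlgebra (𝓡 n) G)]

omit [T2Space G] in
/-- In the fibre over its centre, a symmetry moves `u` to `u · h` where `Ad h⁻¹` is `-id` on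
`𝔤₁`. -/
theorem LocalAut.CoversSymmetryAt.exists_act_eq (hΦ : Φ.CoversSymmetryAt x)
    (hP : IsParabolic (k := k) 𝔤 P) (hE : GradingElement 𝔤.gr E) {u : B} (hu : C.proj u = x) :
    ∃ h : P, Φ.φ u = C.act u h ∧ ∀ Z ∈ 𝔤.gr 1, Ad ((h : G)⁻¹) Z = -Z := by
  have hs : u ∈ Φ.φ.source := by rw [Φ.source_eq, mem_preimage, hu]; exact hΦ.1
  obtain ⟨h, hh⟩ := C.exists_act_eq (u := u) (v := Φ.φ u) (by rw [Φ.covers u hs, hu, hΦ.2.1])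
  refine ⟨h, hh.symm, fun Z hZ => ?_⟩
  have h1 : Ad (h : G) Z = -Z :=
    IsParabolic.Ad_eq_neg hE (h : G) (fun X => hΦ.Ad_add_mem hP hu hh X) hZ
  have h2 := Ad_inv_Ad (h : G) Z
  rw [h1, map_neg] at h2
  rw [← h2, neg_neg, h2]

/-- `φ (φ u) = u · h · h`, and `Ad h⁻¹` acts on `E + 𝔤₁` as an affine map with linear part `-1`,
hence as an involution. It is not required that `φ ∘ φ` be the identity on the fibre. -/
theorem IsWeylFun.localAut_localAut (hΦ : Φ.CoversSymmetryAt x) (hP : IsParabolic (k := k) 𝔤 P)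
    (hE : GradingElement 𝔤.gr E) (hx : x ∈ V) (hF : IsWeylFun 𝔤 C E V F) {u : B}
    (hu : C.proj u = x) : F (Φ.φ (Φ.φ u)) = F u := by
  obtain ⟨h, hh, hZ⟩ := hΦ.exists_act_eq hP hE hu
  have hs : u ∈ Φ.φ.source := by rw [Φ.source_eq, mem_preimage, hu]; exact hΦ.1
  have huV : C.proj u ∈ V := hu ▸ hx
  have h1 := hZ _ (hP.mul_expIn_mem_G0 hE h).1
  have h2 := hZ _ (hF.mem u huV)
  have h3 : Φ.φ (Φ.φ u) = C.act (C.act u h) h := by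
    conv_lhs => rw [hh, Φ.map_act u hs, hh]
  rw [map_sub] at h1 h2
  rw [h3, hF.equivariant _ (by rwa [C.proj_act]), hF.equivariant _ huV]
  set A := Ad (n := n) ((h : G)⁻¹)
  have h4 : A (F u) = A E + E - F u := by rw [sub_eq_iff_eq_add] at h2; rw [h2]; abel
  have h5 : A (A E) = E := by
    rw [← sub_sub_cancel (A E) (A (A E)), h1]; abel
  rw [h4, map_sub, map_add, h4, h5]
  abel

omit [T2Space G] in
/-- Two Weyl functions which are invariant at the centre of a symmetry agree over the centre. -/
theorem IsWeylFun.eq_of_invariant (hΦ : Φ.CoversSymmetryAt x) (hP : IsParabolic (k := k) 𝔤 P)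
    (hE : GradingElement 𝔤.gr E) (hx : x ∈ V) (hx' : x ∈ V') (hF : IsWeylFun 𝔤 C E V F)
    (hF' : IsWeylFun 𝔤 C E V' F') {u : B} (hu : C.proj u = x) (h : F (Φ.φ u) = F u)
    (h' : F' (Φ.φ u) = F' u) : F u = F' u := by
  obtain ⟨g, hg, hZ⟩ := hΦ.exists_act_eq hP hE hu
  have h1 : F u - F' u ∈ 𝔤.gr 1 := by
    have : F u - F' u = (E - F' u) - (E - F u) := by abel
    rw [this]
    exact sub_mem (hF'.mem u (hu ▸ hx')) (hF.mem u (hu ▸ hx))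
  -- Invariance makes `F u - F' u` a fixed point of `Ad g⁻¹`, which is `-1` on `𝔤₁`.
  have h2 := hZ _ h1
  rw [map_sub, ← hF.equivariant u (hu ▸ hx), ← hF'.equivariant u (hu ▸ hx'), ← hg, h, h'] at h2
  have h3 : (2 : ℝ) • (F u - F' u) = 0 := by
    rw [two_smul]
    nth_rewrite 1 [h2]
    exact neg_add_cancel _
  exact sub_eq_zero.1 ((smul_eq_zero.1 h3).resolve_left two_ne_zero)

omit [LieAlgebra.IsSemisimple ℝ (GroupLieAlgebra (𝓡 n) G)] in
/-- The difference of a Weyl function and its pullback, as a `1`-form. -/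
theorem IsWeylFun.exists_oneForm (hP : IsParabolic (k := k) 𝔤 P) (hE : GradingElement 𝔤.gr E)
    (hF : IsWeylFun 𝔤 C E U F) (hF' : IsWeylFun 𝔤 C E U F') :
    ∃ Υ : Under 𝔤 C → GroupLieAlgebra (𝓡 n) G, IsOneFormOn U Υ ∧
      ∀ u, C.proj u ∈ U → Υ (Under.mk 𝔤 C u) = F u - F' u := by
  choose r hr hrp using fun q : Under 𝔤 C => q.exists_mk
  have key : ∀ u, C.proj u ∈ U → F (r (Under.mk 𝔤 C u)) - F' (r (Under.mk 𝔤 C u)) =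
      F u - F' u := by
    intro u hu
    obtain ⟨Z, hZ, h⟩ := (Under.mk_eq_mk_iff hP hE).1 (hr (Under.mk 𝔤 C u)).symm
    rw [h, hF.act_expIn hP hE hu hZ, hF'.act_expIn hP hE hu hZ, add_sub_add_right_eq_sub]
  refine ⟨fun q => F (r q) - F' (r q), ⟨fun q hq => ?_, fun u hu h _ => ?_, ?_⟩, key⟩
  · have hu : C.proj (r q) ∈ U := by rw [hrp]; exact hq
    have : F (r q) - F' (r q) = (E - F' (r q)) - (E - F (r q)) := by abel
    rw [this]
    exact sub_mem (hF'.mem _ hu) (hF.mem _ hu)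
  · have hu' : C.proj (C.act u h) ∈ U := by rwa [C.proj_act]
    rw [key u hu, key _ hu', hF.equivariant u hu, hF'.equivariant u hu, map_sub]
  · exact (hF.smooth.sub hF'.smooth).congr fun u hu => congrArg toModel (key u hu)

omit [LieAlgebra.IsSemisimple ℝ (GroupLieAlgebra (𝓡 n) G)] in
-- The sign changes because `F` records `E` minus the exponent, and exponents in `𝔤₁` add.
theorem Represents.shift (hP : IsParabolic (k := k) 𝔤 P) (hE : GradingElement 𝔤.gr E)
    (hF : IsWeylFun 𝔤 C E U F) (hr : Represents 𝔤 C E U F σ)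
    {Υ : Under 𝔤 C → GroupLieAlgebra (𝓡 n) G} (hΥ : ∀ q : Under 𝔤 C, q.proj ∈ U → Υ q ∈ 𝔤.gr 1) :
    Represents 𝔤 C E U (fun u => F u - Υ (Under.mk 𝔤 C u)) (WeylSym.shift σ Υ) := by
  intro u hu
  have h : E - F u + Υ (Under.mk 𝔤 C u) = E - (F u - Υ (Under.mk 𝔤 C u)) := by abel
  rw [WeylSym.shift, hr u hu, ← C.act_mul,
    ← hP.expIn_add hE (hF.mem u hu) (hΥ (Under.mk 𝔤 C u) hu), h]

/-- A Weyl function can be made invariant at the centre of a symmetry. -/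
theorem IsWeylFun.invariant_of_half (hΦ : Φ.CoversSymmetryAt x) (hP : IsParabolic (k := k) 𝔤 P)
    (hE : GradingElement 𝔤.gr E) (hx : x ∈ V) (hF : IsWeylFun 𝔤 C E V F)
    (hF' : ∀ u, C.proj u = x → F' u = F u - (1 / 2 : ℝ) • (F u - F (Φ.φ u))) {u : B}
    (hu : C.proj u = x) : F' (Φ.φ u) = F' u := by
  have hs : u ∈ Φ.φ.source := by rw [Φ.source_eq, mem_preimage, hu]; exact hΦ.1
  -- `F'` is the average of `F` and `F ∘ φ` over `x`; composing with `φ` swaps the two terms.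
  rw [hF' u hu, hF' _ (by rw [Φ.covers u hs, hu, hΦ.2.1]),
    hF.localAut_localAut hΦ hP hE hx hu]
  module

theorem exists_isWeylFun_invariant [T2Space M] [SecondCountableTopology M] [IsManifold (𝓡 m) ∞ M]
    (hΦ : Φ.CoversSymmetryAt x) (hP : IsParabolic (k := k) 𝔤 P) (hE : GradingElement 𝔤.gr E) :
    ∃ F, IsWeylFun 𝔤 C E univ F ∧ ∀ u, C.proj u = x → F (Φ.φ u) = F u := by
  obtain ⟨F, hF⟩ := exists_isWeylFun_univ (C := C) hP hE
  obtain ⟨ρ, -, hρ⟩ := (SmoothBumpFunction.nhds_basis_tsupport (I := 𝓡 m) x).mem_iff.1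
    (Φ.base.open_source.mem_nhds hΦ.1)
  have hFφ : IsWeylFun 𝔤 C E Φ.base.source (fun u => F (Φ.φ u)) :=
    hF.comp_localAut Φ fun y hy => ⟨hy, mem_univ _⟩
  have hFs : ∀ W, IsWeylFun 𝔤 C E W F := fun W =>
    ⟨fun u _ => hF.mem u (mem_univ _), fun u _ => hF.equivariant u (mem_univ _),
      hF.smooth.mono fun _ _ => mem_univ _⟩
  -- At `x` the bump function is `1`, giving the average. Off its support `F'` equals `F`, so the
  -- values of `φ` outside its domain do not matter.
  set F' : B → GroupLieAlgebra (𝓡 n) G :=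
    fun u => F u - ((1 / 2 : ℝ) * ρ (C.proj u)) • (F u - F (Φ.φ u)) with hF'
  have h1 : IsWeylFun 𝔤 C E Φ.base.source F' :=
    (hFs _).sub_smul hFφ (ρ := fun y => (1 / 2 : ℝ) * ρ y)
      (contMDiff_const.mul ρ.contMDiff).contMDiffOn
  have h2 : IsWeylFun 𝔤 C E (tsupport ρ)ᶜ F' := (hFs _).congr fun u hu => by
    simp only [hF', image_eq_zero_of_notMem_tsupport hu, mul_zero, zero_smul, sub_zero]
  refine ⟨F', ?_, fun u hu => hF.invariant_of_half hΦ hP hE (mem_univ x) (fun u hu => ?_) hu⟩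
  · have := h1.union Φ.base.open_source (isClosed_tsupport ρ).isOpen_compl h2
    have hU : Φ.base.source ∪ (tsupport ρ)ᶜ = univ := by
      rw [eq_univ_iff_forall]
      intro y
      by_cases hy : y ∈ tsupport ρ
      · exact Or.inl (hρ hy)
      · exact Or.inr hy
    rwa [hU] at this
  · simp only [hF', hu, ρ.eq_one, mul_one]

end Symmetries

end WeylSym

end

theorem mainTheorem2 {n k m : ℕ}
    {G : Type*} [TopologicalSpace G] [T2Space G] [ChartedSpace (EuclideanSpace ℝ (Fin n)) G]
    [Group G] [LieGroup (𝓡 n) ∞ G] [LieAlgebra.IsSemisimple ℝ (GroupLieAlgebra (𝓡 n) G)]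
    (𝔤 : WeylSym.OneGrading (n := n) G)
    (P : Subgroup G) [ChartedSpace (EuclideanSpace ℝ (Fin k)) P] [LieGroup (𝓡 k) ∞ P]
    (hP : WeylSym.IsParabolic (k := k) 𝔤 P)
    {B : Type*} [TopologicalSpace B] [ChartedSpace (EuclideanSpace ℝ (Fin n)) B]
    [IsManifold (𝓡 n) ∞ B]
    {M : Type*} [TopologicalSpace M] [T2Space M] [SecondCountableTopology M]
    [ChartedSpace (EuclideanSpace ℝ (Fin m)) M] [IsManifold (𝓡 m) ∞ M]
    (C : WeylSym.CartanGeometry (n := n) (k := k) (m := m) P B M)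
    (x : M) (Φ : WeylSym.LocalAut C) (hΦ : Φ.CoversSymmetryAt x) :
    -- there is a (global) Weyl structure which is invariant at `x`
    (∃ σ : WeylSym.Under 𝔤 C → B, WeylSym.IsWeylOn univ σ ∧ Φ.InvariantAt x σ) ∧
    -- every Weyl structure `σ'` gives rise to such a one, namely `σ' + (1/2) Υ`
    (∀ σ' : WeylSym.Under 𝔤 C → B, WeylSym.IsWeylOn univ σ' →
      WeylSym.IsWeylOn Φ.base.source (Φ.pullback σ') ∧
      (∃ Υ : WeylSym.Under 𝔤 C → GroupLieAlgebra (𝓡 n) G,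
        WeylSym.IsOneFormOn Φ.base.source Υ ∧
        (∀ q, q.proj ∈ Φ.base.source → Φ.pullback σ' q = WeylSym.shift σ' Υ q) ∧
        (∀ Υ' : WeylSym.Under 𝔤 C → GroupLieAlgebra (𝓡 n) G,
          WeylSym.IsOneFormOn Φ.base.source Υ' →
          (∀ q, q.proj ∈ Φ.base.source → Φ.pullback σ' q = WeylSym.shift σ' Υ' q) →
          ∀ q, q.proj ∈ Φ.base.source → Υ' q = Υ q) ∧
        WeylSym.IsWeylOn Φ.base.source (WeylSym.shift σ' (fun q => (1 / 2 : ℝ) • Υ q)) ∧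
        Φ.InvariantAt x (WeylSym.shift σ' (fun q => (1 / 2 : ℝ) • Υ q)))) ∧
    -- all Weyl structures, defined over neighbourhoods of `x` and invariant at `x`, agree at `x`
    (∀ (V V' : Set M) (σ σ' : WeylSym.Under 𝔤 C → B),
      IsOpen V → x ∈ V → IsOpen V' → x ∈ V' →
      WeylSym.IsWeylOn V σ → WeylSym.IsWeylOn V' σ' →
      Φ.InvariantAt x σ → Φ.InvariantAt x σ' →
      ∀ q, q.proj = x → σ q = σ' q) := by
  have : FiniteDimensional ℝ (GroupLieAlgebra (𝓡 n) G) := inferInstanceAs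
    (FiniteDimensional ℝ (EuclideanSpace ℝ (Fin n)))
  obtain ⟨E, hE⟩ := WeylSym.exists_gradingElement 𝔤.isInternal 𝔤.gr_eq_bot 𝔤.lie_mem
  refine ⟨?_, fun σ' hσ' => ?_, fun V V' σ σ' _ hx _ hx' hσ hσ' hinv hinv' q hq => ?_⟩
  · obtain ⟨F, hF, hFx⟩ := WeylSym.exists_isWeylFun_invariant hΦ hP hE
    obtain ⟨σ, hr⟩ := hF.exists_represents hP hE
    exact ⟨σ, hF.isWeylOn hP hE hr,
      (WeylSym.LocalAut.invariantAt_iff hP hE hΦ (mem_univ x) hF hr).2 hFx⟩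
  · obtain ⟨F, hF, hr⟩ := hσ'.exists_isWeylFun hP hE
    have hFU : WeylSym.IsWeylFun 𝔤 C E Φ.base.source F :=
      ⟨fun u _ => hF.mem u (mem_univ _), fun u _ => hF.equivariant u (mem_univ _),
        hF.smooth.mono fun _ _ => mem_univ _⟩
    have hrU : WeylSym.Represents 𝔤 C E Φ.base.source F σ' := fun u _ => hr u (mem_univ _)
    have hFφ : WeylSym.IsWeylFun 𝔤 C E Φ.base.source (fun u => F (Φ.φ u)) :=
      hF.comp_localAut Φ fun y hy => ⟨hy, mem_univ _⟩
    have hpb : WeylSym.Represents 𝔤 C E Φ.base.source (fun u => F (Φ.φ u)) (Φ.pullback σ') :=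
      fun u hu => Φ.pullback_mk hr hu (mem_univ _)
    obtain ⟨Υ, hΥ, hΥF⟩ := hFU.exists_oneForm hP hE hFφ
    -- Both sides are `u` times an exponential from `𝔤₁`, with exponents `E - F (φ u)` and `E - (F u
    -- - Υ')`; injectivity leaves only `Υ' = F - F ∘ φ`. This gives existence and uniqueness
    -- together.
    have hshift : ∀ Υ' : WeylSym.Under 𝔤 C → GroupLieAlgebra (𝓡 n) G,
        WeylSym.IsOneFormOn Φ.base.source Υ' → ∀ u, C.proj u ∈ Φ.base.source →
          (Φ.pullback σ' (WeylSym.Under.mk 𝔤 C u) =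
            WeylSym.shift σ' Υ' (WeylSym.Under.mk 𝔤 C u) ↔
              Υ' (WeylSym.Under.mk 𝔤 C u) = Υ (WeylSym.Under.mk 𝔤 C u)) := by
      intro Υ' hΥ' u hu
      have h1 : E - (F u - Υ' (WeylSym.Under.mk 𝔤 C u)) ∈ 𝔤.gr 1 := by
        rw [← sub_add]; exact add_mem (hFU.mem u hu) (hΥ'.mem _ hu)
      rw [hpb u hu, hrU.shift hP hE hFU hΥ'.mem u hu, hΥF u hu]
      constructor
      · intro h
        have h2 := sub_right_injective (WeylSym.act_expIn_injOn hP hE (hFφ.mem u hu) h1 h)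
        rw [h2, sub_sub_cancel]
      · intro h
        simp only [h, sub_sub_cancel]
    -- `F - ½ Υ` is the average of `F` and `F ∘ φ`, an affine combination with constant coefficient
    -- `1 / 2`.
    have hhalf : WeylSym.IsWeylFun 𝔤 C E Φ.base.source
        (fun u => F u - (1 / 2 : ℝ) • Υ (WeylSym.Under.mk 𝔤 C u)) :=
      (hFU.sub_smul hFφ (ρ := fun _ => (1 / 2 : ℝ)) contMDiffOn_const).congr fun u hu => by
        rw [hΥF u hu]
    have hrhalf := hrU.shift hP hE hFU (Υ := fun q => (1 / 2 : ℝ) • Υ q)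
      (fun q hq => Submodule.smul_mem _ _ (hΥ.mem q hq))
    refine ⟨hFφ.isWeylOn hP hE hpb, Υ, hΥ, fun q hq => ?_, fun Υ' hΥ' h q hq => ?_,
      hhalf.isWeylOn hP hE hrhalf, ?_⟩
    · obtain ⟨u, rfl, hu⟩ := q.exists_mk
      exact (hshift Υ hΥ u (hu ▸ hq)).2 rfl
    · obtain ⟨u, rfl, hu⟩ := q.exists_mk
      exact (hshift Υ' hΥ' u (hu ▸ hq)).1 (h _ hq)
    · refine (WeylSym.LocalAut.invariantAt_iff hP hE hΦ hΦ.1 hhalf hrhalf).2 fun u hu =>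
        hFU.invariant_of_half (F' := fun u => F u - (1 / 2 : ℝ) • Υ (WeylSym.Under.mk 𝔤 C u))
          hΦ hP hE hΦ.1 (fun u hu => ?_) hu
      rw [hΥF u (hu ▸ hΦ.1)]
  · obtain ⟨F, hF, hr⟩ := hσ.exists_isWeylFun hP hE
    obtain ⟨F', hF', hr'⟩ := hσ'.exists_isWeylFun hP hE
    obtain ⟨u, rfl, hu⟩ := q.exists_mk
    have hu : C.proj u = x := hu.trans hq
    have h1 := (WeylSym.LocalAut.invariantAt_iff hP hE hΦ hx hF hr).1 hinv u hu
    have h2 := (WeylSym.LocalAut.invariantAt_iff hP hE hΦ hx' hF' hr').1 hinv' u hu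
    rw [hr u (hu ▸ hx), hr' u (hu ▸ hx'), hF.eq_of_invariant hΦ hP hE hx hx' hF' hu h1 h2]
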